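/- Let $N\ge 3$ be odd and $L,m_{\rm i},m_{\rm h}>0$ (units $\hbar=1$). Consider $N$ spinless fermions of mass $m_{\rm h}$ (coordinates $x_1,\dots,x_N$) and one impurity of mass $m_{\rm i}$ (coordinate $x_{\rm i}$) in one dimension with periodic boundary conditions of period $L$; the Hilbert space is the space of $L^2$ functions on the torus $(\mathbb R/L\mathbb Z)^{N+1}$ that are antisymmetric in $x_1,\dots,x_N$. Let $$\hat H=\hat H^0_{\rm h}+\frac{\hat p_{\rm i}^2}{2m_{\rm i}}+\sum_{n=1}^N U(x_n-x_{\rm i}),\qquad \hat H^0_{\rm h}=\sum_{n=1}^N\frac{\hat p_n^2}{2m_{\rm h}}-C,\qquad C=\frac{k_{\rm F}^2}{6m_{\rm h}}\,\frac{N(N+1)}{N-1},\qquad k_{\rm F}=\frac{2\pi}{L}\,\frac{N-1}{2},$$ where the interaction is everywhere repulsive and of finite total strength: $U\ge 0$ and $\overline U=\int U(x)\,dx<\infty$. More generally, $U(x)\,dx$ may be any finite positive Borel measure on $\mathbb R$, for example $g\,\delta(x)\,dx$ with $g\ge0$; it acts on the ring through its $L$-periodization (an $L$-periodic $U$ is represented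 by its restriction to one period, so that $\overline U$ is the integral over one period). $\hat H$ is understood as the self-adjoint operator associated with the closure of its quadratic form on antisymmetric trigonometric polynomials. Let $p_0\in\frac{2\pi}{L}\mathbb Z$ be arbitrary, and let $|{\rm FS},p_0\rangle$ be the product of the normalized Slater determinant of the plane waves with momenta $-k_{\rm F},-k_{\rm F}+\frac{2\pi}{L},\dots,k_{\rm F}$ (the Fermi sea) and of the normalized impurity plane wave of momentum $p_0$. Assume that the eigenvalues of $\hat H$ in the subspace of total momentum $p_0$ are nondegenerate. Then the unitary group $e^{-i\hat Ht}$ generated by $\hat H$ exists and is unique, the expectation value $\langle {\rm FS},p_0|e^{i\hat Ht}\hat p_{\rm i}e^{-i\hat Ht}|{\rm FS},p_0\rangle$ is well defined for all $t$ and locally integrable in $t$, the infinite-time momentum $$p_\infty=\lim_{t\to\infty}\frac1t\int_0^t \langle {\rm FS},p_0|e^{i\hat Ht'}\,\hat p_{\rm i}\,e^{-i\hat Ht'}|{\rm FS},p_0\rangle\,dt'$$ exists, and $$|p_\infty|\le\sqrt{p_0^2+\frac{2}{\pi}\,m_{\rm i}\,k_{\rm F}\,\overline U\,\frac{N}{N-1}}\,.$$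 -/

import Mathlib

open MeasureTheory Filter Topology

noncomputable section

namespace MobileImpurity

/-- The data of the model: `N` host fermions and one impurity on a ring of length `L`, masses
`mi` (impurity) and `mh` (host), in units with `ħ = 1`.  The repulsive interaction is a positive
Borel measure `U` on the line: `U(x) dx` for a nonnegative function, `g • δ₀` for the pointlike
interaction.  On the ring, it acts through its `L`-periodization; so an interaction given as an
`L`-periodic function is represented by its restriction to one period. -/
structure System where
  N : ℕ
  L : ℝ
  mi : ℝ
  mh : ℝ
  U : Measure ℝ

/-- The particle labels: `some n` is the `n`-th fermion, `none` is the impurity. -/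
abbrev Label (N : ℕ) : Type := Option (Fin N)

/-- Positions of all particles on the ring, measured in units of `L`. -/
abbrev Config (N : ℕ) : Type := UnitAddTorus (Label N)

/-- Momenta of all particles, measured in units of `2π/L`. -/
abbrev Mode (N : ℕ) : Type := Label N → ℤ

/-- The normalized product Haar measure on configurations. -/
abbrev configMeasure (N : ℕ) : Measure (Config N) :=
  Measure.pi fun _ => (AddCircle.haarAddCircle : Measure UnitAddCircle)

/-- Square integrable wave functions of `N + 1` distinguishable particles. -/
abbrev WaveSpace (N : ℕ) : Type := Lp ℂ 2 (configMeasure N)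

/-- The plane wave `x ↦ exp (2πi ∑ⱼ kⱼ xⱼ)` as an `L²` function. -/
def planeWave {N : ℕ} (k : Mode N) : WaveSpace N :=
  ContinuousMap.toLp (E := ℂ) 2 (configMeasure N) ℂ (UnitAddTorus.mFourier k)

/-- The amplitude of the plane wave `k` in `ψ`. -/
def amplitude {N : ℕ} (ψ : WaveSpace N) (k : Mode N) : ℂ := inner ℂ (planeWave k) ψ

/-- Relabelling of the fermions. -/
def relabel {N : ℕ} {α : Type*} (σ : Equiv.Perm (Fin N)) (x : Label N → α) : Label N → α :=
  x ∘ Equiv.optionCongr σ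

theorem measurePreserving_relabel {N : ℕ} (σ : Equiv.Perm (Fin N)) :
    MeasurePreserving (relabel σ : Config N → Config N) (configMeasure N) (configMeasure N) := by
  have h := measurePreserving_piCongrLeft
    (fun _ : Label N => (AddCircle.haarAddCircle : Measure UnitAddCircle))
    (Equiv.optionCongr σ).symm
  convert h using 1
  funext x i
  have h2 := Equiv.piCongrLeft_apply_apply (fun _ : Label N => UnitAddCircle)
    (Equiv.optionCongr σ).symm x (Equiv.optionCongr σ i)
  rw [Equiv.symm_apply_apply] at h2
  rw [MeasurableEquiv.coe_piCongrLeft, h2]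
  rfl

/-- The action of a permutation of the fermions on wave functions. -/
def permute {N : ℕ} (σ : Equiv.Perm (Fin N)) : WaveSpace N →ₗᵢ[ℂ] WaveSpace N :=
  Lp.compMeasurePreservingₗᵢ ℂ (relabel σ) (measurePreserving_relabel σ)

/-- The sign of a permutation as a complex number. -/
def csign {N : ℕ} (σ : Equiv.Perm (Fin N)) : ℂ := ((Equiv.Perm.sign σ : ℤ) : ℂ)

/-- The Hilbert space of the system: wave functions antisymmetric in the fermions. -/
def fermionSpace (N : ℕ) : Submodule ℂ (WaveSpace N) where
  carrier := {ψ | ∀ σ : Equiv.Perm (Fin N), permute σ ψ = csign σ • ψ}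
  add_mem' := by
    intro ψ φ hψ hφ σ
    rw [map_add, hψ σ, hφ σ, smul_add]
  zero_mem' := by
    intro σ
    rw [map_zero, smul_zero]
  smul_mem' := by
    intro a ψ hψ σ
    rw [map_smul, hψ σ, smul_comm]

/-- A finite combination of plane waves, by its coefficients. -/
abbrev TrigPoly (N : ℕ) : Type := Mode N →₀ ℂ

/-- The values of a finite combination of plane waves. -/
def TrigPoly.eval {N : ℕ} (c : TrigPoly N) (x : Config N) : ℂ :=
  c.sum fun k a => a * UnitAddTorus.mFourier k x

/-- A finite combination of plane waves as an `L²` function. -/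
def TrigPoly.toWave {N : ℕ} (c : TrigPoly N) : WaveSpace N :=
  c.sum fun k a => a • planeWave k

/-- Antisymmetry in the fermions. -/
def TrigPoly.IsAntisymm {N : ℕ} (c : TrigPoly N) : Prop :=
  ∀ (σ : Equiv.Perm (Fin N)) (k : Mode N), c (relabel σ k) = csign σ * c k

theorem permute_planeWave {N : ℕ} (σ : Equiv.Perm (Fin N)) (k : Mode N) :
    permute σ (planeWave (relabel σ k)) = planeWave k := by
  apply Lp.ext
  have h1 := Lp.coeFn_compMeasurePreserving (planeWave (relabel σ k)) (measurePreserving_relabel σ)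
  have h2 := (measurePreserving_relabel σ).quasiMeasurePreserving.ae_eq_comp
    (ContinuousMap.coeFn_toLp (𝕜 := ℂ) (p := 2) (configMeasure N)
      (UnitAddTorus.mFourier (relabel σ k)))
  have h3 := ContinuousMap.coeFn_toLp (𝕜 := ℂ) (p := 2) (configMeasure N)
      (UnitAddTorus.mFourier k)
  refine (h1.trans h2).trans (EventuallyEq.trans ?_ h3.symm)
  refine Eventually.of_forall fun x => ?_
  simp only [Function.comp_apply, UnitAddTorus.mFourier, ContinuousMap.coe_mk, relabel]
  exact Equiv.prod_comp (Equiv.optionCongr σ) fun i => fourier (k i) (x i)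

theorem TrigPoly.IsAntisymm.toWave_mem {N : ℕ} {c : TrigPoly N} (hc : c.IsAntisymm) :
    c.toWave ∈ fermionSpace N := by
  intro σ
  let e : Mode N ≃ Mode N := Equiv.arrowCongr (Equiv.optionCongr σ).symm (Equiv.refl ℤ)
  have he : ∀ k, e k = relabel σ k := fun k => rfl
  have hs : csign σ * csign σ = 1 := by
    rcases Int.units_eq_one_or (Equiv.Perm.sign σ) with h | h <;> simp [csign, h]
  have h1 : c.toWave = c.support.sum fun k => c k • planeWave k := rfl
  have h2 : c.support.sum (fun k => c k • planeWave k)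
      = c.support.sum fun k => c (relabel σ k) • planeWave (relabel σ k) := by
    symm
    refine Finset.sum_equiv e ?_ ?_
    · intro k
      rw [Finsupp.mem_support_iff, Finsupp.mem_support_iff, he, hc σ k]
      have : csign σ ≠ 0 := left_ne_zero_of_mul_eq_one hs
      simp [this]
    · intro k _
      rw [he]
  conv_lhs => rw [h1, h2]
  rw [h1, map_sum, Finset.smul_sum]
  refine Finset.sum_congr rfl fun k _ => ?_
  rw [map_smul, permute_planeWave, hc σ k, mul_smul]

namespace System

variable (S : System)

/-- The momentum quantum `2π/L`. -/
def δk : ℝ := 2 * Real.pi / S.L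

/-- The Fermi momentum. -/
def kF : ℝ := (2 * Real.pi / S.L) * (((S.N : ℝ) - 1) / 2)

/-- The constant that puts the energy of the Fermi sea to zero. -/
def C : ℝ := S.kF ^ 2 / (6 * S.mh) * ((S.N : ℝ) * ((S.N : ℝ) + 1) / ((S.N : ℝ) - 1))

/-- The integral of the potential. -/
def Ubar : ℝ := S.U.real Set.univ

/-- The eigenvalue of `H⁰ = H⁰_h + H⁰_i` on a plane wave. -/
def freeEnergy (k : Mode S.N) : ℝ :=
  (∑ n : Fin S.N, (S.δk * k (some n)) ^ 2 / (2 * S.mh) - S.C)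
    + (S.δk * k none) ^ 2 / (2 * S.mi)

/-- The matrix element `⟨c| V |d⟩` of `V = ∑ₙ U(xₙ - xᵢ)`, in the variable `y = xₙ - xᵢ`: the
position of the `n`-th fermion is replaced by `xᵢ + y` and `y` is integrated against `U(y) dy`.
The factor `1/L` is there because the configuration measure is normalized. -/
def potentialForm (c d : TrigPoly S.N) : ℂ :=
  ∑ n : Fin S.N, ((S.L : ℂ)⁻¹ * ∫ x : Config S.N, ∫ y : ℝ,
    (starRingEnd ℂ (c.eval (Function.update x (some n) (x none + ((y / S.L : ℝ) : UnitAddCircle))))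
      * d.eval (Function.update x (some n) (x none + ((y / S.L : ℝ) : UnitAddCircle))))
    ∂S.U ∂(configMeasure S.N))

/-- The matrix element `⟨c| H |d⟩`, where `H = H⁰_h + H⁰_i + V`. -/
def energyForm (c d : TrigPoly S.N) : ℂ :=
  (d.sum fun k a => starRingEnd ℂ (c k) * (S.freeEnergy k : ℂ) * a) + S.potentialForm c d

/-- The graph of the Hamiltonian: `ψ` is in the domain of `H` and `H ψ = η`.  Here `H` is the
self-adjoint operator of the closure of the quadratic form `energyForm` on antisymmetric
finite combinations of plane waves (the Friedrichs construction): `ψ` is the `L²` limit of a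
sequence that is Cauchy for the form, and the form at `ψ` is represented by `η`. -/
def IsHamiltonian (ψ η : fermionSpace S.N) : Prop :=
  ∃ c : ℕ → TrigPoly S.N, (∀ j, (c j).IsAntisymm) ∧
    Tendsto (fun j => (c j).toWave) atTop (𝓝 (ψ : WaveSpace S.N)) ∧
    Tendsto (fun j : ℕ × ℕ => S.energyForm (c j.1 - c j.2) (c j.1 - c j.2)) atTop (𝓝 0) ∧
    ∀ d : TrigPoly S.N, d.IsAntisymm →
      Tendsto (fun j => S.energyForm d (c j)) atTop
        (𝓝 (inner ℂ d.toWave (η : WaveSpace S.N)))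

/-- `W t = exp (-i H t)`: a strongly continuous one-parameter unitary group whose generator,
with its exact domain, is `-i H`. -/
structure IsPropagator (W : ℝ → (fermionSpace S.N ≃ₗᵢ[ℂ] fermionSpace S.N)) : Prop where
  zero : ∀ ψ, W 0 ψ = ψ
  add : ∀ s t ψ, W (s + t) ψ = W s (W t ψ)
  continuous : ∀ ψ, Continuous fun t => W t ψ
  generator : ∀ ψ η, S.IsHamiltonian ψ η ↔
    HasDerivAt (fun t => W t ψ) (-(Complex.I • η)) 0

/-- `ψ` is in the domain of the impurity momentum operator `p_i`, which multiplies the amplitude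
of each plane wave by the impurity momentum. -/
def InMomentumDomain (ψ : fermionSpace S.N) : Prop :=
  Summable fun k : Mode S.N => ‖((S.δk * k none : ℝ) : ℂ) * amplitude (ψ : WaveSpace S.N) k‖ ^ 2

/-- The expectation value `⟨ψ| p_i |ψ⟩` of the impurity momentum. -/
def momentum (ψ : fermionSpace S.N) : ℝ :=
  ∑' k : Mode S.N, S.δk * k none * ‖amplitude (ψ : WaveSpace S.N) k‖ ^ 2

/-- `ψ` has total momentum `p`. -/
def HasTotalMomentum (p : ℝ) (ψ : fermionSpace S.N) : Prop :=
  ∀ k : Mode S.N, amplitude (ψ : WaveSpace S.N) k ≠ 0 → ∑ j, S.δk * k j = p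

/-- The eigenvalues of `H` in the subspace of total momentum `p` are nondegenerate. -/
def NondegenerateAt (p : ℝ) : Prop :=
  ∀ (E : ℝ) (ψ φ : fermionSpace S.N), S.HasTotalMomentum p ψ → S.HasTotalMomentum p φ →
    S.IsHamiltonian ψ ((E : ℂ) • ψ) → S.IsHamiltonian φ ((E : ℂ) • φ) → ψ ≠ 0 →
    ∃ a : ℂ, φ = a • ψ

/-- The momenta `-(N-1)/2, …, (N-1)/2` of the Fermi sea, for odd `N`, together with the impurity
momentum `n₀`, in units of `2π/L`. -/
def seaMode (n₀ : ℤ) : Mode S.N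
  | none => n₀
  | some n => (n : ℤ) - ((S.N : ℤ) - 1) / 2

/-- The coefficients of `|FS, p₀⟩`: the normalized Slater determinant of the Fermi sea times the
plane wave of the impurity with momentum `p₀ = 2π n₀ / L`. -/
def seaCoeff (n₀ : ℤ) : TrigPoly S.N :=
  ∑ σ : Equiv.Perm (Fin S.N),
    Finsupp.single (relabel σ (S.seaMode n₀)) (csign σ * ((Real.sqrt (S.N.factorial) : ℝ) : ℂ)⁻¹)

theorem seaCoeff_isAntisymm (n₀ : ℤ) : (S.seaCoeff n₀).IsAntisymm := by
  classical
  intro τ k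
  have hmul : ∀ σ, relabel (σ * τ) (S.seaMode n₀) = relabel τ (relabel σ (S.seaMode n₀)) := by
    intro σ
    funext i
    cases i <;> rfl
  have hinj : Function.Injective (relabel τ : Mode S.N → Mode S.N) := by
    intro a b h
    exact (Equiv.optionCongr τ).surjective.injective_comp_right h
  have hcs : ∀ σ, csign (σ * τ) = csign τ * csign σ := by
    intro σ
    simp [csign, mul_comm]
  simp only [seaCoeff, Finsupp.finsetSum_apply, Finset.mul_sum]
  rw [← Equiv.sum_comp (Equiv.mulRight τ)]
  refine Finset.sum_congr rfl fun σ _ => ?_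
  rw [Equiv.coe_mulRight, hmul, hcs, Finsupp.single_apply, Finsupp.single_apply]
  simp only [hinj.eq_iff, mul_ite, mul_zero, mul_assoc]

/-- The initial state `|FS, p₀⟩`, where `p₀ = 2π n₀ / L`. -/
def initialState (n₀ : ℤ) : fermionSpace S.N :=
  ⟨(S.seaCoeff n₀).toWave, (S.seaCoeff_isAntisymm n₀).toWave_mem⟩

end System

end MobileImpurity

end

/-!
Completing the antisymmetric trigonometric polynomials in the norm `⟨c|H|c⟩ + (1 + C) ⟨c|c⟩` gives
the form domain. Its embedding `G` in the Hilbert space is compact, because the kinetic energy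
tends to infinity with the mode while the interaction only adds to the norm. Hence the spectrum of
`H = (G G†)⁻¹ - (1 + C)` is discrete, and `exp (-i H t)` lifts along `G` to the unitary group of
the form domain generated by `(G† G)⁻¹ - (1 + C)`. The impurity momentum is a bounded form there,
so its expectation value is almost periodic in time and has a time mean.

The bound holds at every time. Since `U ≥ 0` and, by the Pauli principle, the fermions have at
least the energy of the Fermi sea, `⟨p_i²⟩ ≤ 2 m_i E` with the conserved energy `E`. In a Slater
determinant the position of a fermion relative to the impurity is uniformly distributed, so the
initial state has `E = p₀² / (2 m_i) + N Ubar / L`.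
-/

noncomputable section

namespace MobileImpurity

section HilbertBasis

variable {ι 𝕜 E : Type*} [RCLike 𝕜] [NormedAddCommGroup E] [InnerProductSpace 𝕜 E]
  (b : HilbertBasis ι 𝕜 E)

theorem hilbertBasis_ext {x y : E} (h : ∀ i, inner 𝕜 (b i) x = inner 𝕜 (b i) y) : x = y := by
  apply b.repr.injective
  ext i
  rw [b.repr_apply_apply, b.repr_apply_apply, h i]

theorem hasSum_norm_inner_sq (x : E) : HasSum (fun i => ‖inner 𝕜 (b i) x‖ ^ 2) (‖x‖ ^ 2) := by
  have h : HasSum (fun i => RCLike.re (inner 𝕜 x (b i) * inner 𝕜 (b i) x))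
      (RCLike.re (inner 𝕜 x x)) :=
    (b.hasSum_inner_mul_inner x x).mapL (RCLike.reCLM : 𝕜 →L[ℝ] ℝ)
  simpa only [inner_mul_symm_re_eq_norm, norm_mul, norm_inner_symm x, ← sq,
    inner_self_eq_norm_sq] using h

theorem norm_le_of_norm_inner_le {x y : E} {C : ℝ} (hC : 0 ≤ C)
    (h : ∀ i, ‖inner 𝕜 (b i) y‖ ≤ C * ‖inner 𝕜 (b i) x‖) : ‖y‖ ≤ C * ‖x‖ := by
  refine (pow_le_pow_iff_left₀ (norm_nonneg y) (by positivity) two_ne_zero).1 ?_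
  rw [mul_pow]
  refine hasSum_le (fun i => ?_) (hasSum_norm_inner_sq b y) ((hasSum_norm_inner_sq b x).mul_left _)
  rw [← mul_pow]
  exact pow_le_pow_left₀ (norm_nonneg _) (h i) 2

theorem mem_of_hilbertBasis_mem {K : Submodule 𝕜 E} (hK : IsClosed (K : Set E))
    (h : ∀ i, b i ∈ K) (x : E) : x ∈ K := by
  have hle : Submodule.span 𝕜 (Set.range b) ≤ K := Submodule.span_le.2 (Set.range_subset_iff.2 h)
  have htop := Submodule.topologicalClosure_minimal _ hle hK
  rw [b.dense_span] at htop
  exact htop trivial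

theorem eq_of_hilbertBasis_eq {F : Type*} [NormedAddCommGroup F] [NormedSpace 𝕜 F]
    {f g : E →L[𝕜] F} (h : ∀ i, f (b i) = g (b i)) : f = g :=
  ContinuousLinearMap.ext_on (Submodule.dense_iff_topologicalClosure_eq_top.2 b.dense_span)
    (Set.forall_mem_range.2 h)

/-- The operator that multiplies the `i`-th coordinate in the Hilbert basis `b` by `m i`. -/
def multiplier (m : ι → 𝕜) (hm : BddAbove (Set.range fun i => ‖m i‖)) : E →L[𝕜] E :=
  b.repr.symm.toContinuousLinearEquiv.toContinuousLinearMap ∘L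
    lp.mapCLM 2 (fun i => m i • ContinuousLinearMap.id 𝕜 𝕜)
      (Real.iSup_nonneg fun i => norm_nonneg (m i))
      (fun i => by simpa [norm_smul] using le_ciSup hm i) ∘L
    b.repr.toContinuousLinearEquiv.toContinuousLinearMap

variable {m : ι → 𝕜} (hm : BddAbove (Set.range fun i => ‖m i‖))

theorem inner_multiplier (x : E) (i : ι) :
    inner 𝕜 (b i) (multiplier b m hm x) = m i * inner 𝕜 (b i) x := by
  rw [← b.repr_apply_apply, ← b.repr_apply_apply]
  change b.repr (b.repr.symm _) i = _
  rw [LinearIsometryEquiv.apply_symm_apply]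
  rfl

theorem norm_multiplier_sub_sum_le (s : Finset ι) {ε : ℝ} (hε : 0 ≤ ε) (hs : ∀ i ∉ s, ‖m i‖ ≤ ε) :
    ‖multiplier b m hm - ∑ i ∈ s, m i • InnerProductSpace.rankOne 𝕜 (b i) (b i)‖ ≤ ε := by
  classical
  refine ContinuousLinearMap.opNorm_le_bound _ hε fun x => norm_le_of_norm_inner_le b hε fun i => ?_
  have hsum : inner 𝕜 (b i) ((∑ j ∈ s, m j • InnerProductSpace.rankOne 𝕜 (b j) (b j)) x)
      = if i ∈ s then m i * inner 𝕜 (b i) x else 0 := by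
    simp [inner_sum, inner_smul_right, orthonormal_iff_ite.1 b.orthonormal]
  rw [sub_apply, inner_sub_right, inner_multiplier, hsum]
  split_ifs with hi
  · simpa using mul_nonneg hε (norm_nonneg _)
  · rw [sub_zero, norm_mul]
    exact mul_le_mul_of_nonneg_right (hs i hi) (norm_nonneg _)

theorem isCompactOperator_rankOne (x y : E) : IsCompactOperator (InnerProductSpace.rankOne 𝕜 x y) :=
  (isCompactOperator_of_locallyCompactSpace_dom (innerSL 𝕜 y)).clm_comp
    (ContinuousLinearMap.toSpanSingleton 𝕜 x)

theorem isCompactOperator_multiplier [CompleteSpace E] (h0 : Tendsto m cofinite (𝓝 0)) :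
    IsCompactOperator (multiplier b m hm) := by
  have hlim : Tendsto (fun s : Finset ι => ∑ i ∈ s, m i • InnerProductSpace.rankOne 𝕜 (b i) (b i))
      atTop (𝓝 (multiplier b m hm)) := by
    classical
    rw [Metric.tendsto_atTop]
    intro ε hε
    have hfin : {i | ¬ ‖m i‖ < ε / 2}.Finite := by
      simpa [Filter.Eventually, Set.compl_ofPred] using
        Metric.tendsto_nhds.1 h0 (ε / 2) (by positivity)
    refine ⟨hfin.toFinset, fun s hs => ?_⟩
    rw [dist_comm, dist_eq_norm]
    refine (norm_multiplier_sub_sum_le b hm s (half_pos hε).le fun i hi => ?_).trans_lt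
      (half_lt_self hε)
    by_contra hlt
    exact hi (hs (hfin.mem_toFinset.2 fun h => hlt h.le))
  refine isCompactOperator_of_tendsto hlim (Eventually.of_forall fun s => ?_)
  exact Submodule.sum_mem (compactOperator (RingHom.id 𝕜) E E) fun i _ =>
    Submodule.smul_mem _ _ (isCompactOperator_rankOne (b i) (b i))

end HilbertBasis

section SpectralTheorem

universe u v w

variable {𝕜 : Type v} {E : Type u} [RCLike 𝕜] [NormedAddCommGroup E] [InnerProductSpace 𝕜 E]
  [CompleteSpace E]

theorem exists_hilbertBasis_of_orthogonalFamily {κ : Type w} {V : κ → Submodule 𝕜 E}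
    [∀ a, CompleteSpace (V a)] (hV : OrthogonalFamily 𝕜 (fun a => V a) fun a => (V a).subtypeₗᵢ)
    (htop : (⨆ a, V a)ᗮ = ⊥) :
    ∃ (ι : Type (max u w)) (b : HilbertBasis ι 𝕜 E) (a : ι → κ), ∀ i, b i ∈ V (a i) := by
  choose w v _ using fun a => exists_hilbertBasis 𝕜 (V a)
  let f : (Σ a, w a) → E := fun i => (v i.1 i.2 : E)
  have hf : Orthonormal 𝕜 f := hV.orthonormal_sigma_orthonormal fun a => (v a).orthonormal
  have hle : ⨆ a, V a ≤ (Submodule.span 𝕜 (Set.range f)).topologicalClosure := by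
    refine iSup_le fun a x hx => ?_
    exact mem_of_hilbertBasis_mem (v a)
      (K := (Submodule.span 𝕜 (Set.range f)).topologicalClosure.comap (V a).subtype)
      ((Submodule.isClosed_topologicalClosure _).preimage (V a).subtypeL.continuous)
      (fun i => Submodule.le_topologicalClosure _ (Submodule.subset_span ⟨⟨a, i⟩, rfl⟩)) ⟨x, hx⟩
  have hbot : (Submodule.span 𝕜 (Set.range f))ᗮ = ⊥ := by
    rw [eq_bot_iff, ← htop, ← Submodule.orthogonal_closure]
    exact Submodule.orthogonal_le hle
  refine ⟨_, HilbertBasis.mkOfOrthogonalEqBot hf hbot, Sigma.fst, fun i => ?_⟩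
  rw [HilbertBasis.coe_mkOfOrthogonalEqBot]
  exact (v i.1 i.2).2

theorem exists_hilbertBasis_eigenvectors {T : E →L[𝕜] E} (hc : IsCompactOperator T)
    (hs : (T : E →ₗ[𝕜] E).IsSymmetric) :
    ∃ (ι : Type (max u v)) (b : HilbertBasis ι 𝕜 E) (τ : ι → ℝ),
      ∀ i, T (b i) = (τ i : 𝕜) • b i := by
  have hcomplete : ∀ μ, CompleteSpace (Module.End.eigenspace (T : E →ₗ[𝕜] E) μ) := fun μ =>
    IsClosed.completeSpace_coe (hs := ContinuousLinearMap.isClosed_eigenspace T μ)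
  obtain ⟨ι, b, μ, hμ⟩ := exists_hilbertBasis_of_orthogonalFamily hs.orthogonalFamily_eigenspaces
    (ContinuousLinearMap.orthogonalComplement_iSup_eigenspaces_eq_bot hc hs)
  refine ⟨ι, b, fun i => RCLike.re (μ i), fun i => ?_⟩
  rw [RCLike.conj_eq_iff_re.1 (hs.conj_eigenvalue_eq_self
    (Module.End.hasEigenvalue_of_hasEigenvector ⟨hμ i, b.orthonormal.ne_zero i⟩))]
  exact Module.End.mem_eigenspace_iff.1 (hμ i)

end SpectralTheorem

section Evolution

/-- The phase factor `exp (-i e t)`. -/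
def phase (e t : ℝ) : ℂ := Complex.exp (-(Complex.I * e * t))

theorem phase_zero (e : ℝ) : phase e 0 = 1 := by simp [phase]

theorem phase_add (e s t : ℝ) : phase e (s + t) = phase e s * phase e t := by
  rw [phase, phase, phase, ← Complex.exp_add]
  push_cast
  ring_nf

theorem phase_neg_mul_phase (e t : ℝ) : phase e (-t) * phase e t = 1 := by
  rw [← phase_add, neg_add_cancel, phase_zero]

theorem conj_phase_mul_phase (e f t : ℝ) :
    starRingEnd ℂ (phase e t) * phase f t = phase (f - e) t := by
  rw [phase, phase, phase, ← Complex.exp_conj, ← Complex.exp_add]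
  simp only [map_neg, map_mul, Complex.conj_I, Complex.conj_ofReal, Complex.ofReal_sub]
  ring_nf

theorem norm_phase (e t : ℝ) : ‖phase e t‖ = 1 := by
  rw [phase, show -(Complex.I * e * t) = ((-(e * t) : ℝ) : ℂ) * Complex.I by push_cast; ring,
    Complex.norm_exp_ofReal_mul_I]

theorem hasDerivAt_phase (e t : ℝ) : HasDerivAt (phase e) (-(Complex.I * e) * phase e t) t := by
  have h : HasDerivAt (fun t : ℝ => -(Complex.I * e * t)) (-(Complex.I * e)) t :=
    ((Complex.ofRealCLM.hasDerivAt (x := t)).const_mul (Complex.I * e)).neg.congr_deriv (by simp)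
  exact h.cexp.congr_deriv (mul_comm _ _)

theorem continuous_phase (e : ℝ) : Continuous (phase e) := by
  unfold phase
  fun_prop

theorem bddAbove_norm_phase {ι : Type*} (e : ι → ℝ) (t : ℝ) :
    BddAbove (Set.range fun i => ‖phase (e i) t‖) :=
  ⟨1, by rintro _ ⟨i, rfl⟩; exact (norm_phase _ _).le⟩

variable {ι E : Type*} [NormedAddCommGroup E] [InnerProductSpace ℂ E] (b : HilbertBasis ι ℂ E)
  (e : ι → ℝ)

/-- The unitary operator `exp (-i H t)`, where `H` has the eigenbasis `b` with eigenvalues `e`. -/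
def evolution (t : ℝ) : E ≃ₗᵢ[ℂ] E where
  toLinearEquiv := LinearEquiv.ofLinearMap
    (multiplier b (fun i => phase (e i) t) (bddAbove_norm_phase e t) : E →ₗ[ℂ] E)
    (multiplier b (fun i => phase (e i) (-t)) (bddAbove_norm_phase e (-t)) : E →ₗ[ℂ] E)
    (LinearMap.ext fun x => hilbertBasis_ext b fun i => by
      simp [inner_multiplier, mul_left_comm (phase (e i) t), ← mul_assoc, phase_neg_mul_phase])
    (LinearMap.ext fun x => hilbertBasis_ext b fun i => by
      simp [inner_multiplier, ← mul_assoc, phase_neg_mul_phase])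
  norm_map' x := by
    refine (sq_eq_sq₀ (norm_nonneg _) (norm_nonneg _)).1 ?_
    refine (hasSum_norm_inner_sq b _).unique ?_
    convert hasSum_norm_inner_sq b x using 3 with i
    rw [← one_mul ‖inner ℂ (b i) x‖, ← norm_phase (e i) t, ← norm_mul]
    exact congrArg _ (inner_multiplier b (bddAbove_norm_phase e t) x i)

theorem inner_evolution (t : ℝ) (x : E) (i : ι) :
    inner ℂ (b i) (evolution b e t x) = phase (e i) t * inner ℂ (b i) x :=
  inner_multiplier b (bddAbove_norm_phase e t) x i

theorem evolution_basis (t : ℝ) (i : ι) : evolution b e t (b i) = phase (e i) t • b i := by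
  classical
  refine hilbertBasis_ext b fun j => ?_
  rw [inner_evolution, inner_smul_right, orthonormal_iff_ite.1 b.orthonormal]
  split_ifs with h
  · rw [h]
  · simp

theorem evolution_zero (x : E) : evolution b e 0 x = x :=
  hilbertBasis_ext b fun i => by rw [inner_evolution, phase_zero, one_mul]

theorem evolution_add (s t : ℝ) (x : E) :
    evolution b e (s + t) x = evolution b e s (evolution b e t x) :=
  hilbertBasis_ext b fun i => by simp only [inner_evolution, phase_add, mul_assoc]

theorem continuous_evolution (x : E) : Continuous fun t => evolution b e t x := by
  let K : Submodule ℂ E :=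
    { carrier := {x | Continuous fun t => evolution b e t x}
      add_mem' := fun hx hy =>
        (Continuous.add hx hy).congr fun t => (map_add (evolution b e t) _ _).symm
      zero_mem' := continuous_const.congr fun t => (map_zero (evolution b e t)).symm
      smul_mem' := fun a _ hx =>
        (Continuous.const_smul hx a).congr fun t => (map_smul (evolution b e t) _ _).symm }
  have hequi : Equicontinuous fun t x => evolution b e t x :=
    (LipschitzWith.uniformEquicontinuous _ 1 fun t => (evolution b e t).lipschitz).equicontinuous
  have hK : IsClosed (K : Set E) := by
    change IsClosed {x | Continuous fun t => evolution b e t x}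
    simp only [continuous_iff_continuousAt, ContinuousAt, Set.ofPred_forall]
    exact isClosed_iInter fun t =>
      hequi.isClosed_setOfPred_tendsto (evolution b e t).continuous
  refine mem_of_hilbertBasis_mem b hK (fun i => ?_) x
  change Continuous fun t => evolution b e t (b i)
  simp only [evolution_basis]
  exact (continuous_phase _).smul continuous_const

theorem inner_eq_of_hasDerivAt_evolution {x y : E}
    (h : HasDerivAt (fun t => evolution b e t x) (-(Complex.I • y)) 0) (i : ι) :
    inner ℂ (b i) y = (e i : ℂ) * inner ℂ (b i) x := by
  have hcoord : HasDerivAt (fun t => inner ℂ (b i) (evolution b e t x))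
      (inner ℂ (b i) (-(Complex.I • y))) 0 :=
    ((innerSL ℂ (b i)).restrictScalars ℝ).hasFDerivAt.comp_hasDerivAt 0 h
  have hphase : HasDerivAt (fun t => phase (e i) t * inner ℂ (b i) x)
      (-(Complex.I * e i) * phase (e i) 0 * inner ℂ (b i) x) 0 :=
    (hasDerivAt_phase (e i) 0).mul_const _
  simp only [inner_evolution] at hcoord
  have hunique := hcoord.unique hphase
  rw [phase_zero, inner_neg_right, inner_smul_right] at hunique
  exact mul_left_cancel₀ Complex.I_ne_zero (by linear_combination -hunique)

theorem evolution_eq_add_integral [CompleteSpace E] {x y : E}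
    (h : ∀ i, inner ℂ (b i) y = (e i : ℂ) * inner ℂ (b i) x) (t : ℝ) :
    evolution b e t x = x + ∫ s in (0 : ℝ)..t, evolution b e s (-(Complex.I • y)) := by
  refine hilbertBasis_ext b fun i => ?_
  have hderiv : ∀ s ∈ Set.uIcc 0 t, HasDerivAt (fun s => phase (e i) s * inner ℂ (b i) x)
      (inner ℂ (b i) (evolution b e s (-(Complex.I • y)))) s := fun s _ => by
    refine ((hasDerivAt_phase (e i) s).mul_const (inner ℂ (b i) x)).congr_deriv ?_
    rw [inner_evolution, inner_neg_right, inner_smul_right, h i]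
    ring
  have hcont := continuous_evolution b e (-(Complex.I • y))
  have hint : ∫ s in (0 : ℝ)..t, inner ℂ (b i) (evolution b e s (-(Complex.I • y)))
      = inner ℂ (b i) (∫ s in (0 : ℝ)..t, evolution b e s (-(Complex.I • y))) :=
    ((innerSL ℂ (b i)).restrictScalars ℝ).intervalIntegral_comp_comm
      (hcont.intervalIntegrable (μ := volume) 0 t)
  rw [inner_add_right, ← hint, intervalIntegral.integral_eq_sub_of_hasDerivAt hderiv
    ((continuous_const.inner hcont).intervalIntegrable _ _), inner_evolution, phase_zero]
  ring

theorem hasDerivAt_evolution_iff [CompleteSpace E] (x y : E) :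
    HasDerivAt (fun t => evolution b e t x) (-(Complex.I • y)) 0 ↔
      ∀ i, inner ℂ (b i) y = (e i : ℂ) * inner ℂ (b i) x := by
  refine ⟨inner_eq_of_hasDerivAt_evolution b e, fun h => ?_⟩
  have hder := ((continuous_evolution b e
    (-(Complex.I • y))).integral_hasStrictDerivAt 0 0).hasDerivAt.const_add x
  rw [evolution_zero] at hder
  exact hder.congr_of_eventuallyEq (Eventually.of_forall (evolution_eq_add_integral b e h))

theorem hasDerivAt_oneParameterGroup {W : ℝ → (E ≃ₗᵢ[ℂ] E)}
    (hadd : ∀ s t x, W (s + t) x = W s (W t x)) {x y : E} (h : HasDerivAt (fun t => W t x) y 0)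
    (t : ℝ) : HasDerivAt (fun s => W s x) (W t y) t := by
  have hshift : HasDerivAt (fun s => W t (W s x)) (W t y) (t - t) := by
    rw [sub_self]
    exact ((W t).toContinuousLinearEquiv.toContinuousLinearMap.restrictScalars
      ℝ).hasFDerivAt.comp_hasDerivAt 0 h
  simpa only [← hadd, add_sub_cancel] using hshift.comp_sub_const t t

theorem eq_phase_smul_of_hasDerivAt {W : ℝ → (E ≃ₗᵢ[ℂ] E)} (h0 : ∀ x, W 0 x = x)
    (hadd : ∀ s t x, W (s + t) x = W s (W t x)) {x : E} {μ : ℝ}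
    (h : HasDerivAt (fun t => W t x) (-(Complex.I • (μ : ℂ) • x)) 0) (t : ℝ) :
    W t x = phase μ t • x := by
  have hder : ∀ s, HasDerivAt (fun s => phase (-μ) s • W s x) 0 s := fun s => by
    refine ((hasDerivAt_phase (-μ) s).smul (hasDerivAt_oneParameterGroup hadd h s)).congr_deriv ?_
    rw [map_neg, map_smul, map_smul, Complex.ofReal_neg]
    module
  have hconst := is_const_of_deriv_eq_zero (fun s => (hder s).differentiableAt)
    (fun s => (hder s).deriv) t 0
  simp only [h0, phase_zero, one_smul] at hconst
  have hinv : phase μ t * phase (-μ) t = 1 := by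
    simp [phase, ← Complex.exp_add]
  rw [← one_smul ℂ (W t x), ← hinv, mul_smul, hconst]

theorem eq_evolution {W : ℝ → (E ≃ₗᵢ[ℂ] E)} (h0 : ∀ x, W 0 x = x)
    (hadd : ∀ s t x, W (s + t) x = W s (W t x))
    (hder : ∀ i, HasDerivAt (fun t => W t (b i)) (-(Complex.I • (e i : ℂ) • b i)) 0) :
    W = evolution b e := by
  funext t
  ext x
  have h : ((W t).toContinuousLinearEquiv : E →L[ℂ] E)
      = ((evolution b e t).toContinuousLinearEquiv : E →L[ℂ] E) :=
    eq_of_hilbertBasis_eq b fun i =>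
      (eq_phase_smul_of_hasDerivAt h0 hadd (hder i) t).trans (evolution_basis b e t i).symm
  exact DFunLike.congr_fun h x

theorem map_evolution {κ F : Type*} [NormedAddCommGroup F] [InnerProductSpace ℂ F]
    (b' : HilbertBasis κ ℂ F) (e' : κ → ℝ) (G : F →L[ℂ] E)
    (hG : ∀ i j, inner ℂ (b i) (G (b' j)) ≠ 0 → e i = e' j) (t : ℝ) (x : F) :
    G (evolution b' e' t x) = evolution b e t (G x) := by
  have h : G ∘L ((evolution b' e' t).toContinuousLinearEquiv : F →L[ℂ] F)
      = ((evolution b e t).toContinuousLinearEquiv : E →L[ℂ] E) ∘L G :=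
    eq_of_hilbertBasis_eq b' fun j => hilbertBasis_ext b fun i => by
      change inner ℂ (b i) (G (evolution b' e' t (b' j)))
        = inner ℂ (b i) (evolution b e t (G (b' j)))
      rw [evolution_basis, map_smul, inner_smul_right, inner_evolution]
      by_cases hij : inner ℂ (b i) (G (b' j)) = 0
      · rw [hij, mul_zero, mul_zero]
      · rw [hG i j hij]
  exact DFunLike.congr_fun h x

end Evolution

section TimeMean

/-- The time average of `f` over `[0, T]`. -/
def timeAverage {F : Type*} [NormedAddCommGroup F] [NormedSpace ℝ F] (f : ℝ → F) (T : ℝ) : F :=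
  (1 / T) • ∫ s in (0 : ℝ)..T, f s

/-- `m` is the infinite-time average of `f`. -/
def HasTimeMean {F : Type*} [NormedAddCommGroup F] [NormedSpace ℝ F] (f : ℝ → F) (m : F) : Prop :=
  Tendsto (timeAverage f) atTop (𝓝 m)

variable {F G : Type*} [NormedAddCommGroup F] [NormedSpace ℝ F] [NormedAddCommGroup G]
  [NormedSpace ℝ G]

theorem timeAverage_add {f g : ℝ → F} (hf : Continuous f) (hg : Continuous g) :
    timeAverage (f + g) = timeAverage f + timeAverage g := by
  funext T
  rw [Pi.add_apply, timeAverage, timeAverage, timeAverage, ← smul_add,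
    ← intervalIntegral.integral_add (hf.intervalIntegrable _ _) (hg.intervalIntegrable _ _)]
  rfl

theorem timeAverage_smul (a : ℂ) (f : ℝ → ℂ) : timeAverage (a • f) = a • timeAverage f := by
  funext T
  simp only [timeAverage, Pi.smul_apply, intervalIntegral.integral_smul, smul_comm a]

theorem norm_timeAverage_le {f : ℝ → F} {C : ℝ} (h : ∀ s, ‖f s‖ ≤ C) (T : ℝ) :
    ‖timeAverage f T‖ ≤ C := by
  have hint := intervalIntegral.norm_integral_le_of_norm_le_const (a := 0) (b := T) fun s _ => h s
  have hC : 0 ≤ C := (norm_nonneg _).trans (h 0)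
  rw [sub_zero] at hint
  calc ‖timeAverage f T‖ = |T|⁻¹ * ‖∫ s in (0 : ℝ)..T, f s‖ := by
        rw [timeAverage, norm_smul, one_div, norm_inv, Real.norm_eq_abs]
    _ ≤ |T|⁻¹ * (C * |T|) := by gcongr
    _ = |T| * |T|⁻¹ * C := by ring
    _ ≤ C := mul_le_of_le_one_left hC mul_inv_le_one

theorem HasTimeMean.norm_le {f : ℝ → F} {m : F} {C : ℝ} (hf : HasTimeMean f m)
    (h : ∀ s, ‖f s‖ ≤ C) : ‖m‖ ≤ C :=
  le_of_tendsto hf.norm (Eventually.of_forall (norm_timeAverage_le h))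

theorem HasTimeMean.mapL [CompleteSpace F] [CompleteSpace G] (L : F →L[ℝ] G) {f : ℝ → F} {m : F}
    (hf : HasTimeMean f m) (hc : Continuous f) : HasTimeMean (fun s => L (f s)) (L m) := by
  refine ((L.continuous.tendsto m).comp hf).congr fun T => ?_
  rw [Function.comp_apply, timeAverage, timeAverage, map_smul,
    L.intervalIntegral_comp_comm (hc.intervalIntegrable _ _)]

theorem HasTimeMean.smul {f : ℝ → ℂ} {m : ℂ} (a : ℂ) (hf : HasTimeMean f m) :
    HasTimeMean (a • f) (a • m) := by
  rw [HasTimeMean, timeAverage_smul]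
  exact Tendsto.const_smul hf a

theorem integral_phase {e : ℝ} (he : e ≠ 0) (T : ℝ) :
    ∫ s in (0 : ℝ)..T, phase e s = (phase e T - 1) / (-(Complex.I * e)) := by
  have hne : -(Complex.I * e) ≠ 0 := by simp [he]
  have hder : ∀ s ∈ Set.uIcc 0 T,
      HasDerivAt (fun s => phase e s / (-(Complex.I * e))) (phase e s) s := fun s _ =>
    ((hasDerivAt_phase e s).div_const (-(Complex.I * e))).congr_deriv (mul_div_cancel_left₀ _ hne)
  rw [intervalIntegral.integral_eq_sub_of_hasDerivAt hder
    ((continuous_phase e).intervalIntegrable _ _), phase_zero, sub_div]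

theorem hasTimeMean_phase_zero : HasTimeMean (phase 0) 1 := by
  refine tendsto_const_nhds.congr' ?_
  filter_upwards [eventually_ne_atTop 0] with T hT
  simp [timeAverage, phase, hT]

theorem hasTimeMean_phase {e : ℝ} (he : e ≠ 0) : HasTimeMean (phase e) 0 := by
  have hlim : Tendsto (fun T : ℝ => 1 / T * (2 / |e|)) atTop (𝓝 0) := by
    simpa using (tendsto_inv_atTop_zero (𝕜 := ℝ)).mul_const (2 / |e|)
  refine squeeze_zero_norm' ?_ hlim
  filter_upwards [eventually_gt_atTop 0] with T hT
  have hnum : ‖phase e T - 1‖ ≤ 2 := by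
    refine (norm_sub_le _ _).trans ?_
    rw [norm_phase, norm_one]
    norm_num
  have hden : ‖-(Complex.I * (e : ℂ))‖ = |e| := by simp
  rw [timeAverage, integral_phase he, norm_smul,
    Real.norm_of_nonneg (by positivity : (0 : ℝ) ≤ 1 / T), norm_div, hden]
  gcongr

theorem exists_hasTimeMean_phase (e : ℝ) : ∃ m, HasTimeMean (phase e) m := by
  obtain rfl | he := eq_or_ne e 0
  exacts [⟨1, hasTimeMean_phase_zero⟩, ⟨0, hasTimeMean_phase he⟩]

/-- Convergence is expressed by the Cauchy criterion, which is a convergence to the fixed limit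
`0` and hence a closed condition for an equicontinuous family. -/
theorem isClosed_setOf_exists_tendsto {α X Y : Type*} [PseudoMetricSpace X] [MetricSpace Y]
    [CompleteSpace Y] {l : Filter α} [l.NeBot] {f : α → X → Y} {K : NNReal}
    (hf : ∀ a, LipschitzWith K (f a)) : IsClosed {x | ∃ y, Tendsto (fun a => f a x) l (𝓝 y)} := by
  have hcauchy : ∀ x, (∃ y, Tendsto (fun a => f a x) l (𝓝 y)) ↔
      Tendsto (fun p : α × α => dist (f p.1 x) (f p.2 x)) (l ×ˢ l) (𝓝 0) := fun x => by
    rw [← cauchy_map_iff_exists_tendsto, cauchy_map_iff, Metric.uniformity_eq_comap_nhds_zero,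
      tendsto_comap_iff, and_iff_right ‹l.NeBot›]
    rfl
  have hequi : Equicontinuous fun (p : α × α) x => dist (f p.1 x) (f p.2 x) :=
    (LipschitzWith.uniformEquicontinuous _ (2 * max K K) fun p : α × α =>
      LipschitzWith.dist.comp ((hf p.1).prodMk (hf p.2))).equicontinuous
  simp only [hcauchy]
  exact hequi.isClosed_setOfPred_tendsto continuous_const

variable {ι E : Type*} [NormedAddCommGroup E] [InnerProductSpace ℂ E] (b : HilbertBasis ι ℂ E)

theorem exists_hasTimeMean_of_hilbertBasis (f : E →ₗ[ℂ] ℝ → ℂ) (hc : ∀ x, Continuous (f x))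
    {C : NNReal} (hC : ∀ x s, ‖f x s‖ ≤ C * ‖x‖) (hb : ∀ i, ∃ m, HasTimeMean (f (b i)) m) (x : E) :
    ∃ m, HasTimeMean (f x) m := by
  let K : Submodule ℂ E :=
    { carrier := {x | ∃ m, HasTimeMean (f x) m}
      add_mem' := by
        rintro x y ⟨m, hm⟩ ⟨n, hn⟩
        refine ⟨m + n, ?_⟩
        rw [map_add, HasTimeMean, timeAverage_add (hc x) (hc y)]
        exact Tendsto.add hm hn
      zero_mem' := by
        obtain ⟨m, hm⟩ := exists_hasTimeMean_phase 0
        exact ⟨_, by simpa only [zero_smul, map_zero] using hm.smul 0⟩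
      smul_mem' := by
        rintro a x ⟨m, hm⟩
        exact ⟨_, by simpa only [map_smul] using hm.smul a⟩ }
  have hlip : ∀ T, LipschitzWith C fun x => timeAverage (f x) T := fun T =>
    LipschitzWith.of_dist_le_mul fun x y => by
      have hsub : f x = f (x - y) + f y := by rw [← map_add, sub_add_cancel]
      rw [dist_eq_norm, dist_eq_norm, hsub, timeAverage_add (hc _) (hc _), Pi.add_apply,
        add_sub_cancel_right]
      exact norm_timeAverage_le (hC _) T
  exact mem_of_hilbertBasis_mem b (K := K) (isClosed_setOf_exists_tendsto hlip) hb x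

variable (e : ι → ℝ)

theorem continuous_inner_evolution (X : E →L[ℂ] E) (x y : E) :
    Continuous fun s => inner ℂ (evolution b e s x) (X (evolution b e s y)) :=
  (continuous_evolution b e x).inner (X.continuous.comp (continuous_evolution b e y))

/-- The matrix element of the Heisenberg evolution of `X` between `x` and a varying state. -/
def heisenberg (X : E →L[ℂ] E) (x : E) : E →ₗ[ℂ] ℝ → ℂ where
  toFun y s := inner ℂ (evolution b e s x) (X (evolution b e s y))
  map_add' y z := funext fun s => by simp only [map_add, inner_add_right, Pi.add_apply]
  map_smul' a y := funext fun s => by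
    simp only [map_smul, inner_smul_right, Pi.smul_apply, smul_eq_mul, RingHom.id_apply]

theorem exists_hasTimeMean_heisenberg_of_hilbertBasis (X : E →L[ℂ] E) {x : E}
    (h : ∀ i, ∃ m, HasTimeMean (heisenberg b e X x (b i)) m) (y : E) :
    ∃ m, HasTimeMean (heisenberg b e X x y) m := by
  refine exists_hasTimeMean_of_hilbertBasis b (heisenberg b e X x)
    (continuous_inner_evolution b e X x) (C := ‖x‖₊ * ‖X‖₊) (fun z s => ?_) h y
  calc ‖heisenberg b e X x z s‖
      ≤ ‖evolution b e s x‖ * (‖X‖ * ‖evolution b e s z‖) :=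
        (norm_inner_le_norm _ _).trans (by gcongr; exact X.le_opNorm _)
    _ = ‖x‖ * ‖X‖ * ‖z‖ := by
        rw [LinearIsometryEquiv.norm_map, LinearIsometryEquiv.norm_map, mul_assoc]

theorem exists_hasTimeMean_heisenberg_basis (X : E →L[ℂ] E) (i j : ι) :
    ∃ m, HasTimeMean (heisenberg b e X (b i) (b j)) m := by
  obtain ⟨m, hm⟩ := exists_hasTimeMean_phase (e j - e i)
  have h : heisenberg b e X (b i) (b j) = inner ℂ (b i) (X (b j)) • phase (e j - e i) := by
    funext s
    change inner ℂ (evolution b e s (b i)) (X (evolution b e s (b j))) = _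
    rw [evolution_basis, evolution_basis, map_smul, inner_smul_left, inner_smul_right, ← mul_assoc,
      conj_phase_mul_phase, mul_comm]
    rfl
  rw [h]
  exact ⟨_, hm.smul _⟩

theorem exists_hasTimeMean_inner_evolution [CompleteSpace E] (X : E →L[ℂ] E) (x y : E) :
    ∃ m, HasTimeMean (fun s => inner ℂ (evolution b e s x) (X (evolution b e s y))) m := by
  refine exists_hasTimeMean_heisenberg_of_hilbertBasis b e X (fun j => ?_) y
  obtain ⟨m, hm⟩ := exists_hasTimeMean_heisenberg_of_hilbertBasis b e X.adjoint
    (exists_hasTimeMean_heisenberg_basis b e X.adjoint j) x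
  have hconj : HasTimeMean
      (fun s => starRingEnd ℂ (heisenberg b e X.adjoint (b j) x s)) (starRingEnd ℂ m) :=
    hm.mapL (Complex.conjCLE : ℂ →L[ℝ] ℂ) (continuous_inner_evolution b e X.adjoint (b j) x)
  refine ⟨starRingEnd ℂ m, ?_⟩
  convert hconj using 1
  funext s
  change inner ℂ (evolution b e s x) (X (evolution b e s (b j)))
    = starRingEnd ℂ (inner ℂ (evolution b e s (b j)) (X.adjoint (evolution b e s x)))
  rw [inner_conj_symm, ContinuousLinearMap.adjoint_inner_left]

end TimeMean

section Friedrichs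

universe u v

variable {V : Type*} {E : Type u} {Q : Type v} [AddCommGroup V] [Module ℂ V]
  [NormedAddCommGroup E] [InnerProductSpace ℂ E] [NormedAddCommGroup Q] [InnerProductSpace ℂ Q]

/-- The graph of the Friedrichs operator of the quadratic form `q`, whose form core `V` is mapped
into the Hilbert space `E` by `ι`. -/
def IsFriedrichs (ι : V →ₗ[ℂ] E) (q : V → V → ℂ) (x y : E) : Prop :=
  ∃ v : ℕ → V, Tendsto (fun n => ι (v n)) atTop (𝓝 x) ∧
    Tendsto (fun n : ℕ × ℕ => q (v n.1 - v n.2) (v n.1 - v n.2)) atTop (𝓝 0) ∧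
    ∀ u, Tendsto (fun n => q u (v n)) atTop (𝓝 (inner ℂ (ι u) y))

/-- `Q` is the completion of the form core `V` for the form `q` shifted by `μ`, with canonical map
`j`, and `G` is the extension of `ι : V → E` to `Q`. -/
structure IsFormCompletion (ι : V →ₗ[ℂ] E) (q : V → V → ℂ) (μ : ℝ) (j : V →ₗ[ℂ] Q)
    (G : Q →L[ℂ] E) : Prop where
  denseRange : DenseRange j
  inner_map : ∀ u v, inner ℂ (j u) (j v) = q u v + μ * inner ℂ (ι u) (ι v)
  map_apply : ∀ v, G (j v) = ι v

variable {ι : V →ₗ[ℂ] E} {q : V → V → ℂ} {μ : ℝ} {j : V →ₗ[ℂ] Q} {G : Q →L[ℂ] E}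

theorem IsFormCompletion.form_eq (h : IsFormCompletion ι q μ j G) (u v : V) :
    q u v = inner ℂ (j u) (j v) - μ * inner ℂ (G (j u)) (G (j v)) := by
  rw [h.inner_map, h.map_apply, h.map_apply, add_sub_cancel_right]

theorem IsFormCompletion.norm_map_sq (h : IsFormCompletion ι q μ j G) (v : V) :
    ‖j v‖ ^ 2 = (q v v).re + μ * ‖ι v‖ ^ 2 := by
  rw [← inner_self_eq_norm_sq (𝕜 := ℂ), ← inner_self_eq_norm_sq (𝕜 := ℂ), h.inner_map]
  exact (Complex.add_re _ _).trans (congrArg _ (Complex.re_ofReal_mul _ _))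

theorem IsFormCompletion.cauchySeq (h : IsFormCompletion ι q μ j G) {v : ℕ → V}
    (hι : CauchySeq fun n => ι (v n))
    (hq : Tendsto (fun n : ℕ × ℕ => q (v n.1 - v n.2) (v n.1 - v n.2)) atTop (𝓝 0)) :
    CauchySeq fun n => j (v n) := by
  have hdist : ∀ n : ℕ × ℕ, dist (j (v n.1)) (j (v n.2)) ^ 2
      = (q (v n.1 - v n.2) (v n.1 - v n.2)).re + μ * dist (ι (v n.1)) (ι (v n.2)) ^ 2 := fun n => by
    rw [dist_eq_norm, dist_eq_norm, ← map_sub, ← map_sub, h.norm_map_sq]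
  rw [cauchySeq_iff_tendsto_dist_atTop_0] at hι ⊢
  have hsq : Tendsto (fun n : ℕ × ℕ => dist (j (v n.1)) (j (v n.2)) ^ 2) atTop (𝓝 0) := by
    simp only [hdist]
    simpa using ((Complex.continuous_re.tendsto 0).comp hq).add ((hι.pow 2).const_mul μ)
  simpa only [Real.sqrt_sq dist_nonneg, Real.sqrt_zero] using hsq.sqrt

theorem IsFormCompletion.isFriedrichs_iff_exists [CompleteSpace Q]
    (h : IsFormCompletion ι q μ j G) (x y : E) :
    IsFriedrichs ι q x y ↔
      ∃ f : Q, G f = x ∧ ∀ u, inner ℂ (j u) f = inner ℂ (ι u) (y + (μ : ℂ) • x) := by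
  constructor
  · rintro ⟨v, hx, hq, hy⟩
    obtain ⟨f, hf⟩ := cauchySeq_tendsto_of_complete (h.cauchySeq hx.cauchySeq hq)
    have hGf : Tendsto (fun n => ι (v n)) atTop (𝓝 (G f)) :=
      ((G.continuous.tendsto f).comp hf).congr fun n => h.map_apply (v n)
    refine ⟨f, tendsto_nhds_unique hGf hx, fun u => ?_⟩
    have hlim := (hy u).add (((tendsto_const_nhds (x := ι u)).inner (𝕜 := ℂ) hx).const_mul (μ : ℂ))
    simp only [← h.inner_map] at hlim
    rw [inner_add_right, inner_smul_right]
    exact tendsto_nhds_unique ((tendsto_const_nhds (x := j u)).inner hf) hlim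
  · rintro ⟨f, rfl, hf⟩
    obtain ⟨w, hw, hwf⟩ := mem_closure_iff_seq_limit.1 (h.denseRange f)
    choose v hv using hw
    have hj : Tendsto (fun n => j (v n)) atTop (𝓝 f) := by simpa only [hv] using hwf
    have hG : Tendsto (fun n => G (j (v n))) atTop (𝓝 (G f)) := (G.continuous.tendsto f).comp hj
    refine ⟨v, by simpa only [h.map_apply] using hG, ?_, fun u => ?_⟩
    · have hj0 : Tendsto (fun n : ℕ × ℕ => j (v n.1 - v n.2)) atTop (𝓝 (f - f)) := by
        simp only [map_sub, ← prod_atTop_atTop_eq]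
        exact (hj.comp tendsto_fst).sub (hj.comp tendsto_snd)
      have hG0 := (G.continuous.tendsto _).comp hj0
      simp only [h.form_eq]
      simpa using (hj0.inner (𝕜 := ℂ) hj0).sub ((hG0.inner (𝕜 := ℂ) hG0).const_mul (μ : ℂ))
    · have hlim := ((tendsto_const_nhds (x := j u)).inner (𝕜 := ℂ) hj).sub
        (((tendsto_const_nhds (x := G (j u))).inner (𝕜 := ℂ) hG).const_mul (μ : ℂ))
      simp only [h.form_eq]
      rw [hf u, ← h.map_apply, inner_add_right, inner_smul_right, add_sub_cancel_right] at hlim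
      rwa [← h.map_apply u]

variable [CompleteSpace E] [CompleteSpace Q]

/-- In other words, the Friedrichs operator is `(G G†)⁻¹ - μ`. -/
theorem IsFormCompletion.isFriedrichs_iff (h : IsFormCompletion ι q μ j G) (x y : E) :
    IsFriedrichs ι q x y ↔ G (G.adjoint (y + (μ : ℂ) • x)) = x := by
  have hadj : ∀ f, (∀ u, inner ℂ (j u) f = inner ℂ (ι u) (y + (μ : ℂ) • x)) ↔
      f = G.adjoint (y + (μ : ℂ) • x) := fun f => by
    simp only [← h.map_apply, ← ContinuousLinearMap.adjoint_inner_right]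
    exact ⟨fun hf => h.denseRange.eq_of_inner_right ℂ hf, fun hf _ => by rw [hf]⟩
  rw [h.isFriedrichs_iff_exists]
  simp only [hadj, exists_eq_right]

theorem IsFormCompletion.eq_zero_of_adjoint_eq_zero (h : IsFormCompletion ι q μ j G)
    (hι : DenseRange ι) {x : E} (hx : G.adjoint x = 0) : x = 0 :=
  hι.eq_zero_of_inner_right ℂ fun v => by
    rw [← h.map_apply, ← ContinuousLinearMap.adjoint_inner_right, hx, inner_zero_right]

theorem inner_comp_adjoint_of_eigenvector {x : E} {τ : ℝ} (hx : G (G.adjoint x) = (τ : ℂ) • x)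
    (y : E) : inner ℂ x (G (G.adjoint y)) = τ * inner ℂ x y := by
  rw [← ContinuousLinearMap.adjoint_inner_left, ContinuousLinearMap.adjoint_inner_right, hx,
    inner_smul_left, Complex.conj_ofReal]

theorem ne_zero_of_comp_adjoint_apply_eq_smul (h0 : ∀ x, G.adjoint x = 0 → x = 0) {x : E}
    (hx : x ≠ 0) {τ : ℂ} (hτ : G (G.adjoint x) = τ • x) : τ ≠ 0 := by
  rintro rfl
  refine hx (h0 x (norm_eq_zero.1 ?_))
  rw [← sq_eq_zero_iff, ← inner_self_eq_norm_sq (𝕜 := ℂ), ContinuousLinearMap.adjoint_inner_left,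
    hτ, zero_smul, inner_zero_right, map_zero]

theorem IsFormCompletion.isFriedrichs_iff_inner (h : IsFormCompletion ι q μ j G)
    (hι : DenseRange ι) {κ : Type*} (b : HilbertBasis κ ℂ E) {τ : κ → ℝ}
    (hτ : ∀ i, G (G.adjoint (b i)) = (τ i : ℂ) • b i) (x y : E) :
    IsFriedrichs ι q x y ↔
      ∀ i, inner ℂ (b i) y = (((τ i)⁻¹ - μ : ℝ) : ℂ) * inner ℂ (b i) x := by
  have hne : ∀ i, (τ i : ℂ) ≠ 0 := fun i =>
    ne_zero_of_comp_adjoint_apply_eq_smul (fun _ => h.eq_zero_of_adjoint_eq_zero hι)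
      (b.orthonormal.ne_zero i) (hτ i)
  rw [h.isFriedrichs_iff]
  refine ⟨fun hx i => ?_, fun hy => hilbertBasis_ext b fun i => ?_⟩
  · have hi := inner_comp_adjoint_of_eigenvector (hτ i) (y + (μ : ℂ) • x)
    rw [hx, inner_add_right, inner_smul_right] at hi
    have := hne i
    push_cast
    field_simp
    linear_combination -hi
  · have := hne i
    rw [inner_comp_adjoint_of_eigenvector (hτ i), inner_add_right, inner_smul_right, hy i]
    push_cast
    field_simp
    ring

theorem exists_hilbertBasis_evolution_comm (hG : IsCompactOperator G) {κ : Type*}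
    (b : HilbertBasis κ ℂ E) {τ : κ → ℝ}
    (hτ : ∀ i, G (G.adjoint (b i)) = (τ i : ℂ) • b i) (μ : ℝ) :
    ∃ (κ' : Type v) (b' : HilbertBasis κ' ℂ Q) (e' : κ' → ℝ), ∀ t f,
      G (evolution b' e' t f) = evolution b (fun i => (τ i)⁻¹ - μ) t (G f) := by
  obtain ⟨κ', b', τ', hτ'⟩ := exists_hilbertBasis_eigenvectors (T := G.adjoint ∘L G)
    (hG.clm_comp G.adjoint) G.isPositive_adjoint_comp_self.isSymmetric
  refine ⟨κ', b', fun k => (τ' k)⁻¹ - μ, map_evolution b _ b' _ G fun i k hik => ?_⟩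
  have hcomm : (τ i : ℂ) * inner ℂ (b i) (G (b' k)) = τ' k * inner ℂ (b i) (G (b' k)) := by
    have heigen : G.adjoint (G (b' k)) = (τ' k : ℂ) • b' k := hτ' k
    rw [← inner_comp_adjoint_of_eigenvector (hτ i), heigen, map_smul, inner_smul_right]
  rw [Complex.ofReal_injective (mul_right_cancel₀ hik hcomm)]

theorem IsFormCompletion.exists_hilbertBasis (h : IsFormCompletion ι q μ j G)
    (hι : DenseRange ι) (hG : IsCompactOperator G) :
    ∃ (κ : Type u) (b : HilbertBasis κ ℂ E) (e : κ → ℝ),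
      (∀ x y, IsFriedrichs ι q x y ↔ ∀ i, inner ℂ (b i) y = e i * inner ℂ (b i) x) ∧
      ∃ (κ' : Type v) (b' : HilbertBasis κ' ℂ Q) (e' : κ' → ℝ), ∀ t f,
        G (evolution b' e' t f) = evolution b e t (G f) := by
  obtain ⟨κ, b, τ, hτ⟩ := exists_hilbertBasis_eigenvectors (T := G ∘L G.adjoint)
    (hG.comp_clm G.adjoint) G.isPositive_self_comp_adjoint.isSymmetric
  exact ⟨κ, b, _, h.isFriedrichs_iff_inner hι b hτ, exists_hilbertBasis_evolution_comm hG b hτ μ⟩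

end Friedrichs

section Fourier

variable {N : ℕ}

/-- The plane waves as a Hilbert basis of the space of wave functions. -/
def planeWaveBasis (N : ℕ) : HilbertBasis (Mode N) ℂ (WaveSpace N) :=
  UnitAddTorus.mFourierBasis

theorem planeWaveBasis_apply (k : Mode N) : planeWaveBasis N k = planeWave k :=
  congrFun UnitAddTorus.coe_mFourierBasis k

theorem inner_planeWave [DecidableEq (Mode N)] (k l : Mode N) :
    inner ℂ (planeWave k) (planeWave l) = if k = l then 1 else 0 := by
  simpa only [planeWaveBasis_apply] using orthonormal_iff_ite.1 (planeWaveBasis N).orthonormal k l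

theorem amplitude_eq_inner (ψ : WaveSpace N) (k : Mode N) :
    amplitude ψ k = inner ℂ (planeWaveBasis N k) ψ := by
  rw [planeWaveBasis_apply, amplitude]

theorem amplitude_ext {ψ φ : WaveSpace N} (h : ∀ k, amplitude ψ k = amplitude φ k) : ψ = φ :=
  hilbertBasis_ext (planeWaveBasis N) fun k => by
    rw [← amplitude_eq_inner, ← amplitude_eq_inner, h]

theorem hasSum_conj_amplitude_mul (ψ φ : WaveSpace N) :
    HasSum (fun k => starRingEnd ℂ (amplitude ψ k) * amplitude φ k) (inner ℂ ψ φ) := by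
  simpa only [amplitude_eq_inner, inner_conj_symm] using
    (planeWaveBasis N).hasSum_inner_mul_inner ψ φ

theorem hasSum_norm_amplitude_sq (ψ : WaveSpace N) :
    HasSum (fun k => ‖amplitude ψ k‖ ^ 2) (‖ψ‖ ^ 2) := by
  simpa only [amplitude_eq_inner] using hasSum_norm_inner_sq (planeWaveBasis N) ψ

theorem amplitude_multiplier {m : Mode N → ℂ} (hm : BddAbove (Set.range fun k => ‖m k‖))
    (ψ : WaveSpace N) (k : Mode N) :
    amplitude (multiplier (planeWaveBasis N) m hm ψ) k = m k * amplitude ψ k := by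
  rw [amplitude_eq_inner, amplitude_eq_inner, inner_multiplier]

/-- The combination of plane waves with the coefficients `c` multiplied by the weights `w`. -/
def weightedWave (w : Mode N → ℂ) : TrigPoly N →ₗ[ℂ] WaveSpace N :=
  Finsupp.linearCombination ℂ fun k => w k • planeWave k

theorem amplitude_weightedWave (w : Mode N → ℂ) (c : TrigPoly N) (k : Mode N) :
    amplitude (weightedWave w c) k = w k * c k := by
  classical
  rw [weightedWave, Finsupp.linearCombination_apply, amplitude, Finsupp.sum, inner_sum]
  simp only [inner_smul_right, inner_planeWave, mul_ite, mul_one, mul_zero, Finset.sum_ite_eq,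
    Finsupp.mem_support_iff]
  split_ifs with h
  · exact mul_comm _ _
  · rw [not_not.1 h, mul_zero]

theorem inner_weightedWave (w : Mode N → ℂ) (c d : TrigPoly N) :
    inner ℂ (weightedWave w c) (weightedWave w d)
      = d.sum fun k a => starRingEnd ℂ (c k) * (starRingEnd ℂ (w k) * w k) * a := by
  have h := hasSum_conj_amplitude_mul (weightedWave w c) (weightedWave w d)
  simp only [amplitude_weightedWave] at h
  refine (h.unique (hasSum_sum_of_ne_finset_zero fun k hk => ?_)).trans
    (Finset.sum_congr (s₁ := d.support) rfl fun k _ => by rw [map_mul]; ring)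
  rw [Finsupp.notMem_support_iff.1 hk, mul_zero, mul_zero]

theorem toWave_eq_weightedWave (c : TrigPoly N) : c.toWave = weightedWave 1 c := by
  simp [TrigPoly.toWave, weightedWave, Finsupp.linearCombination_apply]

theorem inner_toWave (c d : TrigPoly N) :
    inner ℂ c.toWave d.toWave = d.sum fun k a => starRingEnd ℂ (c k) * a := by
  simp only [toWave_eq_weightedWave, inner_weightedWave, Pi.one_apply, map_one, mul_one]

end Fourier

section Antisymmetry

variable {N : ℕ}

theorem csign_mul_self (σ : Equiv.Perm (Fin N)) : csign σ * csign σ = 1 := by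
  rcases Int.units_eq_one_or (Equiv.Perm.sign σ) with h | h <;> simp [csign, h]

theorem csign_mul (σ τ : Equiv.Perm (Fin N)) : csign (σ * τ) = csign σ * csign τ := by
  simp [csign]

theorem relabel_mul {α : Type*} (σ τ : Equiv.Perm (Fin N)) (x : Label N → α) :
    relabel (σ * τ) x = relabel τ (relabel σ x) := by
  funext i
  cases i <;> rfl

theorem relabel_injective {α : Type*} (σ : Equiv.Perm (Fin N)) :
    Function.Injective (relabel σ : (Label N → α) → Label N → α) :=
  (Equiv.optionCongr σ).surjective.injective_comp_right

theorem relabel_swap_eq {α : Type*} {x : Label N → α} {m n : Fin N} (h : x (some m) = x (some n)) :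
    relabel (Equiv.swap m n) x = x := by
  funext i
  cases i with
  | none => rfl
  | some l =>
    change x (some (Equiv.swap m n l)) = x (some l)
    rw [Equiv.swap_apply_def]
    split_ifs with hm hn
    · rw [hm, h]
    · rw [hn, h]
    · rfl

theorem amplitude_relabel {ψ : WaveSpace N} (hψ : ψ ∈ fermionSpace N) (σ : Equiv.Perm (Fin N))
    (k : Mode N) : amplitude ψ (relabel σ k) = csign σ * amplitude ψ k := by
  rw [amplitude, ← (permute σ).inner_map_map, permute_planeWave, hψ σ, inner_smul_right]
  rfl

theorem injective_of_amplitude_ne_zero {ψ : WaveSpace N} (hψ : ψ ∈ fermionSpace N) {k : Mode N}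
    (hk : amplitude ψ k ≠ 0) : Function.Injective fun n : Fin N => k (some n) := by
  intro m n hmn
  by_contra hne
  have h := amplitude_relabel hψ (Equiv.swap m n) k
  rw [relabel_swap_eq hmn, csign, Equiv.Perm.sign_swap hne] at h
  push_cast at h
  exact hk (by linear_combination h / 2)

theorem isClosed_fermionSpace (N : ℕ) : IsClosed (fermionSpace N : Set (WaveSpace N)) := by
  have h : (fermionSpace N : Set (WaveSpace N))
      = ⋂ σ : Equiv.Perm (Fin N), {ψ | permute σ ψ = csign σ • ψ} := by
    ext ψ
    simp [fermionSpace]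
  rw [h]
  exact isClosed_iInter fun σ => isClosed_eq (permute σ).continuous (continuous_const_smul _)

instance (N : ℕ) : CompleteSpace (fermionSpace N) :=
  (isClosed_fermionSpace N).completeSpace_coe

/-- The space of antisymmetric finite combinations of plane waves. -/
def antisymmPoly (N : ℕ) : Submodule ℂ (TrigPoly N) where
  carrier := {c | c.IsAntisymm}
  add_mem' hc hd σ k := by
    rw [Finsupp.add_apply, Finsupp.add_apply, hc σ k, hd σ k, mul_add]
  zero_mem' σ k := by rw [Finsupp.zero_apply, Finsupp.zero_apply, mul_zero]
  smul_mem' a c hc σ k := by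
    rw [Finsupp.smul_apply, Finsupp.smul_apply, hc σ k, smul_eq_mul, smul_eq_mul, mul_left_comm]

/-- An antisymmetric finite combination of plane waves as a fermionic state. -/
def toFermion (N : ℕ) : antisymmPoly N →ₗ[ℂ] fermionSpace N :=
  ((weightedWave 1).domRestrict (antisymmPoly N)).codRestrict (fermionSpace N) fun c => by
    rw [LinearMap.domRestrict_apply, ← toWave_eq_weightedWave]
    exact TrigPoly.IsAntisymm.toWave_mem c.2

theorem coe_toFermion (c : antisymmPoly N) :
    (toFermion N c : WaveSpace N) = (c : TrigPoly N).toWave :=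
  (toWave_eq_weightedWave _).symm

/-- The amplitude of a permutation in a normalized Slater determinant. -/
def slaterCoeff (σ : Equiv.Perm (Fin N)) : ℂ := csign σ * ((√N.factorial : ℝ) : ℂ)⁻¹

theorem conj_slaterCoeff_mul_csign (σ : Equiv.Perm (Fin N)) :
    starRingEnd ℂ (slaterCoeff σ) * csign σ = ((√N.factorial : ℝ) : ℂ)⁻¹ := by
  rw [slaterCoeff, map_mul, map_inv₀, Complex.conj_ofReal, csign, map_intCast, mul_right_comm,
    ← csign, csign_mul_self, one_mul]

/-- The normalized Slater determinant of the plane waves with the fermion momenta of `k`, times the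
plane wave of the impurity. -/
def slater (k : Mode N) : TrigPoly N :=
  ∑ σ : Equiv.Perm (Fin N), Finsupp.single (relabel σ k) (slaterCoeff σ)

theorem isAntisymm_slater (k : Mode N) : (slater k).IsAntisymm := by
  classical
  intro τ l
  simp only [slater, slaterCoeff, Finsupp.finsetSum_apply, Finset.mul_sum]
  rw [← Equiv.sum_comp (Equiv.mulRight τ)]
  refine Finset.sum_congr rfl fun σ _ => ?_
  rw [Equiv.coe_mulRight, relabel_mul, csign_mul, mul_comm (csign σ), Finsupp.single_apply,
    Finsupp.single_apply]
  simp only [(relabel_injective τ).eq_iff, mul_ite, mul_zero, mul_assoc]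

theorem toWave_slater (k : Mode N) :
    (slater k).toWave = ∑ σ, slaterCoeff σ • planeWave (relabel σ k) := by
  simp only [toWave_eq_weightedWave, slater, map_sum, weightedWave,
    Finsupp.linearCombination_single, Pi.one_apply, one_smul]

theorem inner_toWave_slater {ψ : WaveSpace N} (hψ : ψ ∈ fermionSpace N) (k : Mode N) :
    inner ℂ (slater k).toWave ψ = ((√N.factorial : ℝ) : ℂ) * amplitude ψ k := by
  have hterm (σ : Equiv.Perm (Fin N)) : inner ℂ (slaterCoeff σ • planeWave (relabel σ k)) ψ
      = ((√N.factorial : ℝ) : ℂ)⁻¹ * amplitude ψ k := by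
    rw [inner_smul_left, ← amplitude, amplitude_relabel hψ, ← mul_assoc,
      conj_slaterCoeff_mul_csign]
  rw [toWave_slater, sum_inner, Finset.sum_congr rfl fun σ _ => hterm σ, Finset.sum_const,
    Finset.card_univ, Fintype.card_perm, Fintype.card_fin, nsmul_eq_mul, ← mul_assoc,
    ← div_eq_mul_inv, ← Complex.ofReal_natCast, ← Complex.ofReal_div, Real.div_sqrt]

theorem denseRange_toFermion (N : ℕ) : DenseRange (toFermion N) := by
  change Dense (LinearMap.range (toFermion N) : Set (fermionSpace N))
  rw [Submodule.dense_iff_topologicalClosure_eq_top, Submodule.topologicalClosure_eq_top_iff,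
    Submodule.eq_bot_iff]
  intro ψ hψ
  refine Subtype.ext (amplitude_ext fun k => ?_)
  have h : inner ℂ (slater k).toWave (ψ : WaveSpace N) = 0 := by
    rw [← coe_toFermion ⟨slater k, isAntisymm_slater k⟩, ← Submodule.coe_inner]
    exact hψ _ (LinearMap.mem_range_self _ _)
  have hN : ((√N.factorial : ℝ) : ℂ) ≠ 0 :=
    Complex.ofReal_ne_zero.2 (Real.sqrt_pos.2 (Nat.cast_pos.2 N.factorial_pos)).ne'
  rw [inner_toWave_slater ψ.2] at h
  rw [(mul_eq_zero.1 h).resolve_left hN]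
  exact (inner_zero_right _).symm

end Antisymmetry

section FermiSea

theorem sum_le_sum_of_card_eq {α : Type*} {s t : Finset α} (hst : s.card = t.card)
    {f : α → ℝ} {a : ℝ} (hs : ∀ x ∈ s, f x ≤ a) (ht : ∀ x ∉ s, a ≤ f x) :
    ∑ x ∈ s, f x ≤ ∑ x ∈ t, f x := by
  classical
  rw [← Finset.sum_inter_add_sum_sdiff s t, ← Finset.sum_inter_add_sum_sdiff t s,
    Finset.inter_comm]
  refine add_le_add le_rfl ?_
  calc ∑ x ∈ s \ t, f x ≤ (s \ t).card • a :=
        Finset.sum_le_card_nsmul _ _ _ fun x hx => hs x (Finset.mem_sdiff.1 hx).1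
    _ = (t \ s).card • a := by rw [Finset.card_sdiff_comm hst]
    _ ≤ ∑ x ∈ t \ s, f x :=
        Finset.card_nsmul_le_sum _ _ _ fun x hx => ht x (Finset.mem_sdiff.1 hx).2

theorem sum_sq_Icc_le {N M : ℕ} (hNM : N = 2 * M + 1) {f : Fin N → ℤ}
    (hf : Function.Injective f) :
    ∑ k ∈ Finset.Icc (-M : ℤ) M, (k : ℝ) ^ 2 ≤ ∑ n, (f n : ℝ) ^ 2 := by
  have hcard : (Finset.Icc (-M : ℤ) M).card = (Finset.univ.map ⟨f, hf⟩).card := by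
    rw [Int.card_Icc, Finset.card_map, Finset.card_univ, Fintype.card_fin]
    omega
  have h := sum_le_sum_of_card_eq hcard (f := fun k : ℤ => (k : ℝ) ^ 2) (a := (M : ℝ) ^ 2)
    (fun k hk => ?_) (fun k hk => ?_)
  · rwa [Finset.sum_map] at h
  · have hkM : |k| ≤ |(M : ℤ)| := by grind
    exact_mod_cast sq_le_sq.2 hkM
  · have hkM : |(M : ℤ)| ≤ |k| := by grind
    exact_mod_cast sq_le_sq.2 hkM

theorem sum_sq_Icc (M : ℕ) :
    ∑ k ∈ Finset.Icc (-M : ℤ) M, (k : ℝ) ^ 2 = M * (M + 1) * (2 * M + 1) / 3 := by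
  induction M with
  | zero => simp
  | succ M ih =>
    have h := Finset.sum_Icc_succ_eq_add_endpoints (fun k : ℤ => (k : ℝ) ^ 2) (N := M)
    push_cast at h ⊢
    rw [h, ih]
    ring

namespace System

variable {S : System}

theorem δk_pos (hL : 0 < S.L) : 0 < S.δk := by
  unfold δk
  positivity

theorem C_eq_sum_sq {M : ℕ} (hM : S.N = 2 * M + 1) (hM0 : M ≠ 0) :
    S.C = S.δk ^ 2 / (2 * S.mh) * ∑ k ∈ Finset.Icc (-M : ℤ) M, (k : ℝ) ^ 2 := by
  have hN : (S.N : ℝ) = 2 * M + 1 := by exact_mod_cast hM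
  rw [C, kF, ← δk, sum_sq_Icc, hN]
  field_simp
  ring

theorem seaMode_some_injective (n₀ : ℤ) :
    Function.Injective fun n : Fin S.N => S.seaMode n₀ (some n) := fun m n h => by
  simp only [seaMode] at h
  omega

theorem map_seaMode_some {M : ℕ} (hM : S.N = 2 * M + 1) (n₀ : ℤ) :
    Finset.univ.map ⟨_, S.seaMode_some_injective n₀⟩ = Finset.Icc (-M : ℤ) M := by
  refine Finset.eq_of_subset_of_card_le (fun k hk => ?_) ?_
  · obtain ⟨n, -, rfl⟩ := Finset.mem_map.1 hk
    simp only [Function.Embedding.coeFn_mk, seaMode, Finset.mem_Icc]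
    omega
  · rw [Int.card_Icc, Finset.card_map, Finset.card_univ, Fintype.card_fin]
    omega

theorem freeEnergy_eq {M : ℕ} (hM : S.N = 2 * M + 1) (hM0 : M ≠ 0) (k : Mode S.N) :
    S.freeEnergy k = S.δk ^ 2 / (2 * S.mh)
      * (∑ n, (k (some n) : ℝ) ^ 2 - ∑ l ∈ Finset.Icc (-M : ℤ) M, (l : ℝ) ^ 2)
      + (S.δk * k none) ^ 2 / (2 * S.mi) := by
  have hhost : ∑ n, (S.δk * k (some n)) ^ 2 / (2 * S.mh)
      = S.δk ^ 2 / (2 * S.mh) * ∑ n, (k (some n) : ℝ) ^ 2 := by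
    simp only [Finset.mul_sum, mul_pow, div_mul_eq_mul_div]
  rw [freeEnergy, C_eq_sum_sq hM hM0, hhost, mul_sub]

theorem impurityEnergy_le_freeEnergy (hN : Odd S.N) (hN1 : 1 < S.N) (hmh : 0 < S.mh)
    {k : Mode S.N} (hk : Function.Injective fun n : Fin S.N => k (some n)) :
    (S.δk * k none) ^ 2 / (2 * S.mi) ≤ S.freeEnergy k := by
  obtain ⟨M, hM⟩ := hN
  rw [freeEnergy_eq hM (by omega), le_add_iff_nonneg_left]
  exact mul_nonneg (by positivity) (sub_nonneg.2 (sum_sq_Icc_le hM hk))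

theorem freeEnergy_seaMode (hN : Odd S.N) (hN1 : 1 < S.N) (n₀ : ℤ) :
    S.freeEnergy (S.seaMode n₀) = (S.δk * n₀) ^ 2 / (2 * S.mi) := by
  obtain ⟨M, hM⟩ := hN
  rw [freeEnergy_eq hM (by omega), ← map_seaMode_some hM n₀, Finset.sum_map]
  simp [seaMode]

theorem freeEnergy_relabel (σ : Equiv.Perm (Fin S.N)) (k : Mode S.N) :
    S.freeEnergy (relabel σ k) = S.freeEnergy k := by
  have h : ∑ n : Fin S.N, (S.δk * relabel σ k (some n)) ^ 2 / (2 * S.mh)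
      = ∑ n : Fin S.N, (S.δk * k (some n)) ^ 2 / (2 * S.mh) :=
    Equiv.sum_comp σ fun n => (S.δk * (k (some n) : ℤ)) ^ 2 / (2 * S.mh)
  rw [freeEnergy, freeEnergy, h]
  rfl

end System

end FermiSea

section FormWeight

theorem tendsto_sum_mul_sq_cofinite {ι : Type*} [Fintype ι] {a : ι → ℝ} (ha : ∀ i, 0 < a i) :
    Tendsto (fun k : ι → ℤ => ∑ i, a i * (k i : ℝ) ^ 2) cofinite atTop := by
  refine tendsto_atTop.2 fun R => ?_
  have hcoord (i : ι) : {z : ℤ | a i * (z : ℝ) ^ 2 < R}.Finite := by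
    obtain ⟨M, hM⟩ := exists_nat_gt (R / a i)
    refine (Set.finite_Icc (-M : ℤ) M).subset fun z (hz : a i * (z : ℝ) ^ 2 < R) => ?_
    have hsq : (z : ℝ) ^ 2 < M := ((lt_div_iff₀' (ha i)).2 hz).trans hM
    have hsq' : z ^ 2 < M := by exact_mod_cast hsq
    exact Set.mem_Icc.2 ⟨by nlinarith, by nlinarith⟩
  refine (Set.Finite.pi' hcoord).subset fun k (hk : ¬ R ≤ ∑ i, a i * (k i : ℝ) ^ 2) i => ?_
  refine lt_of_le_of_lt ?_ (not_le.1 hk)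
  exact Finset.single_le_sum (f := fun i => a i * (k i : ℝ) ^ 2)
    (fun j _ => mul_nonneg (ha j).le (sq_nonneg _)) (Finset.mem_univ i)

namespace System

variable {S : System}

/-- The square root of the kinetic energy `freeEnergy k + C` shifted by `1`: the weight of the
plane wave `k` in the norm of the form domain. The absolute value has no effect for positive
masses; it makes the weight at least `1` in all cases. -/
def formWeight (S : System) (k : Mode S.N) : ℝ := √(1 + |S.freeEnergy k + S.C|)

theorem one_le_formWeight (k : Mode S.N) : 1 ≤ S.formWeight k :=
  Real.one_le_sqrt.2 (le_add_of_nonneg_right (abs_nonneg _))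

theorem formWeight_sq (hmi : 0 < S.mi) (hmh : 0 < S.mh) (k : Mode S.N) :
    S.formWeight k ^ 2 = S.freeEnergy k + (1 + S.C) := by
  have h : 0 ≤ S.freeEnergy k + S.C := by
    rw [freeEnergy, add_right_comm, sub_add_cancel]
    positivity
  rw [formWeight, abs_of_nonneg h, Real.sq_sqrt (by positivity)]
  ring

theorem tendsto_formWeight (hL : 0 < S.L) (hmi : 0 < S.mi) (hmh : 0 < S.mh) :
    Tendsto S.formWeight cofinite atTop := by
  have hδ := δk_pos hL
  let a : Label S.N → ℝ := fun i => i.elim (S.δk ^ 2 / (2 * S.mi)) fun _ => S.δk ^ 2 / (2 * S.mh)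
  have ha : ∀ i, 0 < a i := by
    rintro (_ | _)
    exacts [show 0 < S.δk ^ 2 / (2 * S.mi) by positivity,
      show 0 < S.δk ^ 2 / (2 * S.mh) by positivity]
  have hkin (k : Mode S.N) : S.freeEnergy k + S.C = ∑ i, a i * (k i : ℝ) ^ 2 := by
    rw [freeEnergy, Fintype.sum_option]
    simp only [a, Option.elim, mul_pow, div_mul_eq_mul_div]
    ring
  refine Real.tendsto_sqrt_atTop.comp (tendsto_atTop_add_const_left _ _ ?_)
  simp only [hkin]
  exact tendsto_abs_atTop_atTop.comp (tendsto_sum_mul_sq_cofinite ha)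

theorem bddAbove_div_formWeight {m : Mode S.N → ℂ}
    (hm : ∃ a, ∀ k, ‖m k‖ ≤ a * S.formWeight k) :
    BddAbove (Set.range fun k => ‖m k / S.formWeight k‖) := by
  obtain ⟨a, ha⟩ := hm
  refine ⟨a, Set.forall_mem_range.2 fun k => ?_⟩
  have hk : 0 < S.formWeight k := zero_lt_one.trans_le (one_le_formWeight k)
  rw [norm_div, Complex.norm_real, Real.norm_of_nonneg hk.le, div_le_iff₀ hk]
  exact ha k

theorem exists_norm_one_le_mul_formWeight :
    ∃ a, ∀ k, ‖(1 : Mode S.N → ℂ) k‖ ≤ a * S.formWeight k :=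
  ⟨1, fun k => by simpa using one_le_formWeight k⟩

theorem exists_norm_impurityMomentum_le (hmi : 0 < S.mi) (hmh : 0 < S.mh) :
    ∃ a, ∀ k : Mode S.N, ‖((S.δk * k none : ℝ) : ℂ)‖ ≤ a * S.formWeight k := by
  refine ⟨√(2 * S.mi), fun k => ?_⟩
  have hhost : 0 ≤ ∑ n : Fin S.N, (S.δk * k (some n)) ^ 2 / (2 * S.mh) := by positivity
  have hk : (S.δk * k none) ^ 2 / (2 * S.mi) ≤ S.formWeight k ^ 2 := by
    rw [formWeight_sq hmi hmh, freeEnergy]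
    linarith
  rw [Complex.norm_real, Real.norm_eq_abs]
  refine abs_le_of_sq_le_sq ?_ (mul_nonneg (Real.sqrt_nonneg _) (Real.sqrt_nonneg _))
  rw [mul_pow √_, Real.sq_sqrt (by positivity)]
  exact (div_le_iff₀' (by positivity)).1 hk

end System

end FormWeight

section FormDomain

/-- A finite combination of plane waves as a continuous function. -/
def trigPolyMap (N : ℕ) : TrigPoly N →ₗ[ℂ] C(Config N, ℂ) :=
  Finsupp.linearCombination ℂ UnitAddTorus.mFourier

theorem trigPolyMap_apply {N : ℕ} (c : TrigPoly N) (x : Config N) :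
    trigPolyMap N c x = c.eval x := by
  simp [trigPolyMap, TrigPoly.eval, Finsupp.linearCombination_apply, Finsupp.sum]

namespace System

variable {S : System}

/-- The energy form on the antisymmetric trigonometric polynomials. -/
def coreForm (S : System) (c d : antisymmPoly S.N) : ℂ := S.energyForm c d

theorem isHamiltonian_iff_isFriedrichs (ψ η : fermionSpace S.N) :
    S.IsHamiltonian ψ η ↔ IsFriedrichs (toFermion S.N) S.coreForm ψ η := by
  constructor
  · rintro ⟨c, hc, hlim, hcauchy, hrep⟩
    refine ⟨fun n => ⟨c n, hc n⟩, tendsto_subtype_rng.2 ?_, hcauchy, fun d => ?_⟩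
    · simpa only [coe_toFermion] using hlim
    · simpa only [coreForm, Submodule.coe_inner, coe_toFermion] using hrep d.1 d.2
  · rintro ⟨c, hlim, hcauchy, hrep⟩
    refine ⟨fun n => (c n).1, fun n => (c n).2, ?_, hcauchy, fun d hd => ?_⟩
    · simpa only [coe_toFermion] using tendsto_subtype_rng.1 hlim
    · simpa only [coreForm, Submodule.coe_inner, coe_toFermion] using hrep ⟨d, hd⟩

/-- The configuration `x` with the `n`-th fermion moved to the distance `y` from the impurity. -/
def contact (S : System) (n : Fin S.N) (z : Config S.N × ℝ) : Config S.N :=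
  Function.update z.1 (some n) (z.1 none + ((z.2 / S.L : ℝ) : UnitAddCircle))

theorem continuous_contact (n : Fin S.N) : Continuous (S.contact n) := by
  refine Continuous.update continuous_fst _ ?_
  refine (continuous_apply none |>.comp continuous_fst).add ?_
  exact (AddCircle.continuous_mk' 1).comp (continuous_snd.div_const _)

/-- The measure `∑ₙ U(xₙ - xᵢ) dx` on configurations, whose `L²` space carries the interaction
part of the form norm. -/
def contactMeasure (S : System) : Measure (Config S.N) :=
  ENNReal.ofReal S.L⁻¹ • ∑ n, ((configMeasure S.N).prod S.U).map (S.contact n)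

variable [IsFiniteMeasure S.U]

instance : IsFiniteMeasure S.contactMeasure := by
  rw [contactMeasure]
  exact Measure.smul_finite _ ENNReal.ofReal_ne_top

theorem integrable_contact (f : C(Config S.N, ℂ)) (n : Fin S.N) :
    Integrable (fun z => f (S.contact n z)) ((configMeasure S.N).prod S.U) :=
  (f.continuous.integrable_of_hasCompactSupport
    (HasCompactSupport.of_compactSpace f)).comp_measurable (continuous_contact n).measurable

theorem integral_contactMeasure (hL : 0 < S.L) (f : C(Config S.N, ℂ)) :
    ∫ x, f x ∂S.contactMeasure
      = ∑ n, (S.L : ℂ)⁻¹ * ∫ x, ∫ y, f (S.contact n (x, y)) ∂S.U ∂configMeasure S.N := by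
  rw [contactMeasure, integral_smul_measure, integral_finsetSum_measure fun n _ =>
    f.continuous.integrable_of_hasCompactSupport (HasCompactSupport.of_compactSpace f),
    ENNReal.toReal_ofReal (inv_nonneg.2 hL.le), Finset.smul_sum]
  refine Finset.sum_congr rfl fun n _ => ?_
  rw [integral_map (continuous_contact n).measurable.aemeasurable
    f.continuous.aestronglyMeasurable, Complex.real_smul, Complex.ofReal_inv,
    integral_prod _ (integrable_contact f n)]

/-- The canonical map of trigonometric polynomials into the sum of the spaces that carry the kinetic
and the interaction part of the form norm. -/
def formMap (S : System) [IsFiniteMeasure S.U] :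
    TrigPoly S.N →ₗ[ℂ] WithLp 2 (WaveSpace S.N × Lp ℂ 2 S.contactMeasure) :=
  (WithLp.linearEquiv 2 ℂ _).symm.toLinearMap ∘ₗ
    (weightedWave fun k => (S.formWeight k : ℂ)).prod
      ((ContinuousMap.toLp 2 S.contactMeasure ℂ).toLinearMap ∘ₗ trigPolyMap S.N)

theorem potentialForm_eq_inner (hL : 0 < S.L) (c d : TrigPoly S.N) :
    S.potentialForm c d = inner ℂ (ContinuousMap.toLp 2 S.contactMeasure ℂ (trigPolyMap S.N c))
      (ContinuousMap.toLp 2 S.contactMeasure ℂ (trigPolyMap S.N d)) := by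
  rw [ContinuousMap.inner_toLp]
  refine .trans ?_ (integral_contactMeasure hL (trigPolyMap S.N d * star (trigPolyMap S.N c))).symm
  simp only [potentialForm, contact, ContinuousMap.mul_apply, ContinuousMap.star_apply,
    trigPolyMap_apply, mul_comm, RCLike.star_def]

theorem inner_formMap (hL : 0 < S.L) (hmi : 0 < S.mi) (hmh : 0 < S.mh) (c d : TrigPoly S.N) :
    inner ℂ (S.formMap c) (S.formMap d)
      = S.energyForm c d + ((1 + S.C : ℝ) : ℂ) * inner ℂ c.toWave d.toWave := by
  have hw (k : Mode S.N) : starRingEnd ℂ (S.formWeight k : ℂ) * S.formWeight k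
      = S.freeEnergy k + (1 + S.C : ℝ) := by
    rw [Complex.conj_ofReal, ← Complex.ofReal_mul, ← sq, formWeight_sq hmi hmh, Complex.ofReal_add]
  rw [energyForm, potentialForm_eq_inner hL, add_right_comm, WithLp.prod_inner_apply]
  refine congrArg (· + _) ((inner_weightedWave _ c d).trans ?_)
  rw [inner_toWave, Finsupp.mul_sum, ← Finsupp.sum_add]
  refine Finset.sum_congr rfl fun k _ => ?_
  simp only [hw]
  ring

/-- The domain of the closed quadratic form, as the completion of the antisymmetric trigonometric
polynomials. -/
def formDomain (S : System) [IsFiniteMeasure S.U] :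
    Submodule ℂ (WithLp 2 (WaveSpace S.N × Lp ℂ 2 S.contactMeasure)) :=
  ((antisymmPoly S.N).map S.formMap).topologicalClosure

instance : CompleteSpace S.formDomain :=
  (Submodule.isClosed_topologicalClosure _).completeSpace_coe

/-- The form core inside the form domain. -/
def formCore (S : System) [IsFiniteMeasure S.U] : antisymmPoly S.N →ₗ[ℂ] S.formDomain :=
  (S.formMap.domRestrict _).codRestrict _ fun c =>
    Submodule.le_topologicalClosure _ (Submodule.mem_map_of_mem c.2)

theorem denseRange_formCore : DenseRange S.formCore := by
  refine Subtype.dense_iff.2 fun f hf => closure_mono ?_ hf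
  rintro _ ⟨c, hc, rfl⟩
  exact ⟨_, ⟨⟨c, hc⟩, rfl⟩, rfl⟩

/-- The multiplication by `m / formWeight` in momentum space, on the form domain. It extends
`c ↦ m c` on trigonometric polynomials. -/
def formMultiplier (S : System) [IsFiniteMeasure S.U] (m : Mode S.N → ℂ)
    (hm : ∃ a, ∀ k, ‖m k‖ ≤ a * S.formWeight k) : S.formDomain →L[ℂ] WaveSpace S.N :=
  multiplier (planeWaveBasis S.N) (fun k => m k / S.formWeight k) (bddAbove_div_formWeight hm) ∘L
    WithLp.fstL 2 ℂ _ _ ∘L S.formDomain.subtypeL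

theorem amplitude_formMultiplier {m : Mode S.N → ℂ} (hm : ∃ a, ∀ k, ‖m k‖ ≤ a * S.formWeight k)
    (f : S.formDomain) (k : Mode S.N) :
    amplitude (S.formMultiplier m hm f) k = m k / S.formWeight k * amplitude f.1.fst k :=
  amplitude_multiplier (bddAbove_div_formWeight hm) f.1.fst k

theorem formMultiplier_formCore {m : Mode S.N → ℂ} (hm : ∃ a, ∀ k, ‖m k‖ ≤ a * S.formWeight k)
    (c : antisymmPoly S.N) : S.formMultiplier m hm (S.formCore c) = weightedWave m c.1 := by
  refine amplitude_ext fun k => ?_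
  have hk : amplitude (S.formCore c).1.fst k = S.formWeight k * c.1 k :=
    amplitude_weightedWave _ _ _
  rw [amplitude_formMultiplier, amplitude_weightedWave, hk, ← mul_assoc, div_mul_cancel₀]
  exact_mod_cast (zero_lt_one.trans_le (one_le_formWeight k)).ne'

theorem formMultiplier_one_mem (f : S.formDomain) :
    S.formMultiplier 1 exists_norm_one_le_mul_formWeight f ∈ fermionSpace S.N := by
  refine denseRange_formCore.induction_on
    (p := fun f => S.formMultiplier 1 exists_norm_one_le_mul_formWeight f ∈ fermionSpace S.N) f
    ((isClosed_fermionSpace _).preimage (ContinuousLinearMap.continuous _)) fun c => ?_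
  rw [formMultiplier_formCore, ← toWave_eq_weightedWave]
  exact TrigPoly.IsAntisymm.toWave_mem c.2

/-- The embedding of the form domain in the Hilbert space. -/
def formEmbedding (S : System) [IsFiniteMeasure S.U] : S.formDomain →L[ℂ] fermionSpace S.N :=
  (S.formMultiplier 1 exists_norm_one_le_mul_formWeight).codRestrict _ formMultiplier_one_mem

theorem amplitude_formEmbedding (f : S.formDomain) (k : Mode S.N) :
    amplitude (S.formEmbedding f : WaveSpace S.N) k = amplitude f.1.fst k / S.formWeight k := by
  refine (amplitude_formMultiplier _ f k).trans ?_
  rw [Pi.one_apply, one_div_mul_eq_div]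

theorem isCompactOperator_formEmbedding (hL : 0 < S.L) (hmi : 0 < S.mi) (hmh : 0 < S.mh) :
    IsCompactOperator S.formEmbedding := by
  have h0 : Tendsto (fun k : Mode S.N => (1 : Mode S.N → ℂ) k / S.formWeight k) cofinite (𝓝 0) := by
    refine tendsto_zero_iff_norm_tendsto_zero.2 ?_
    simpa [abs_of_nonneg (zero_le_one.trans (one_le_formWeight _)), Function.comp_def] using
      tendsto_inv_atTop_zero.comp (tendsto_formWeight hL hmi hmh)
  have h : IsCompactOperator (S.formMultiplier 1 exists_norm_one_le_mul_formWeight) :=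
    (isCompactOperator_multiplier (planeWaveBasis S.N)
      (bddAbove_div_formWeight exists_norm_one_le_mul_formWeight) h0).comp_clm
      (WithLp.fstL 2 ℂ _ _ ∘L S.formDomain.subtypeL)
  exact h.codRestrict formMultiplier_one_mem (isClosed_fermionSpace _)

theorem isFormCompletion_formCore (hL : 0 < S.L) (hmi : 0 < S.mi) (hmh : 0 < S.mh) :
    IsFormCompletion (toFermion S.N) S.coreForm (1 + S.C) S.formCore
      S.formEmbedding where
  denseRange := denseRange_formCore
  inner_map c d := by
    rw [Submodule.coe_inner, Submodule.coe_inner, coe_toFermion, coe_toFermion]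
    exact inner_formMap hL hmi hmh c.1 d.1
  map_apply c := by
    refine Subtype.ext ((formMultiplier_formCore _ c).trans ?_)
    rw [coe_toFermion, toWave_eq_weightedWave]

/-- The impurity momentum operator on the form domain. -/
def momentumOperator (hmi : 0 < S.mi) (hmh : 0 < S.mh) : S.formDomain →L[ℂ] WaveSpace S.N :=
  S.formMultiplier (fun k => (S.δk * k none : ℝ)) (exists_norm_impurityMomentum_le hmi hmh)

theorem amplitude_momentumOperator (hmi : 0 < S.mi) (hmh : 0 < S.mh) (f : S.formDomain)
    (k : Mode S.N) : amplitude (momentumOperator hmi hmh f) k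
      = ((S.δk * k none : ℝ) : ℂ) * amplitude (S.formEmbedding f : WaveSpace S.N) k := by
  rw [momentumOperator, amplitude_formMultiplier, amplitude_formEmbedding, div_mul_eq_mul_div,
    mul_div_assoc]

theorem hasSum_freeEnergy_mul (hmi : 0 < S.mi) (hmh : 0 < S.mh) (f : S.formDomain) :
    HasSum (fun k => S.freeEnergy k * ‖amplitude (S.formEmbedding f : WaveSpace S.N) k‖ ^ 2)
      (‖f.1.fst‖ ^ 2 - (1 + S.C) * ‖S.formEmbedding f‖ ^ 2) := by
  have h := (hasSum_norm_amplitude_sq f.1.fst).sub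
    ((hasSum_norm_amplitude_sq (S.formEmbedding f : WaveSpace S.N)).mul_left (1 + S.C))
  refine h.congr_fun fun k => ?_
  have hw : S.formWeight k ≠ 0 := (zero_lt_one.trans_le (one_le_formWeight k)).ne'
  rw [amplitude_formEmbedding, norm_div, Complex.norm_real, div_pow, Real.norm_eq_abs, sq_abs,
    eq_sub_of_add_eq (formWeight_sq hmi hmh k).symm]
  field_simp

theorem norm_momentumOperator_sq_le (hN : Odd S.N) (hN1 : 1 < S.N) (hmi : 0 < S.mi)
    (hmh : 0 < S.mh) (f : S.formDomain) :
    ‖momentumOperator hmi hmh f‖ ^ 2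
      ≤ 2 * S.mi * (‖f‖ ^ 2 - (1 + S.C) * ‖S.formEmbedding f‖ ^ 2) := by
  have hfst : ‖f.1.fst‖ ^ 2 ≤ ‖f‖ ^ 2 := by
    rw [Submodule.coe_norm, WithLp.prod_norm_sq_eq_of_L2]
    exact le_add_of_nonneg_right (sq_nonneg _)
  refine (hasSum_le (fun k => ?_) (hasSum_norm_amplitude_sq _)
    ((hasSum_freeEnergy_mul hmi hmh f).mul_left (2 * S.mi))).trans (by gcongr)
  rw [amplitude_momentumOperator, norm_mul, mul_pow, ← mul_assoc, Complex.norm_real,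
    Real.norm_eq_abs, sq_abs]
  by_cases hk : amplitude (S.formEmbedding f : WaveSpace S.N) k = 0
  · simp [hk]
  refine mul_le_mul_of_nonneg_right ?_ (sq_nonneg _)
  exact (div_le_iff₀' (by positivity)).1 (impurityEnergy_le_freeEnergy hN hN1 hmh
    (injective_of_amplitude_ne_zero (S.formEmbedding f).2 hk))

end System

end FormDomain

section Slater

variable {N : ℕ}

theorem inner_sum_smul_planeWave_self {ι : Type*} [Fintype ι] {f : ι → Mode N}
    (hf : Function.Injective f) (a : ι → ℂ) :
    inner ℂ (∑ i, a i • planeWave (f i)) (∑ i, a i • planeWave (f i))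
      = ((∑ i, ‖a i‖ ^ 2 : ℝ) : ℂ) := by
  have h : Orthonormal ℂ fun i => planeWave (f i) := by
    simpa only [Function.comp_def, planeWaveBasis_apply] using
      (planeWaveBasis N).orthonormal.comp f hf
  rw [h.inner_sum]
  simp only [Complex.conj_mul', Complex.ofReal_sum, Complex.ofReal_pow]

theorem norm_slaterCoeff (σ : Equiv.Perm (Fin N)) : ‖slaterCoeff σ‖ = (√N.factorial)⁻¹ := by
  rcases Int.units_eq_one_or (Equiv.Perm.sign σ) with h | h <;> simp [slaterCoeff, csign, h]

theorem sum_norm_slaterCoeff_sq (N : ℕ) :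
    ∑ σ : Equiv.Perm (Fin N), ‖slaterCoeff σ‖ ^ 2 = 1 := by
  simp only [norm_slaterCoeff, inv_pow, Real.sq_sqrt (Nat.cast_nonneg _), Finset.sum_const,
    Finset.card_univ, Fintype.card_perm, Fintype.card_fin, nsmul_eq_mul]
  exact mul_inv_cancel₀ (Nat.cast_ne_zero.2 N.factorial_ne_zero)

theorem relabel_left_injective {α : Type*} {k : Label N → α}
    (hk : Function.Injective fun n : Fin N => k (some n)) :
    Function.Injective fun σ : Equiv.Perm (Fin N) => relabel σ k := fun _ _ h =>
  Equiv.ext fun n => hk (congrFun h (some n))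

theorem inner_toWave_slater_self {k : Mode N}
    (hk : Function.Injective fun n : Fin N => k (some n)) :
    inner ℂ (slater k).toWave (slater k).toWave = 1 := by
  rw [toWave_slater, inner_sum_smul_planeWave_self (relabel_left_injective hk),
    sum_norm_slaterCoeff_sq, Complex.ofReal_one]

/-- The momenta after the momentum of the `n`-th fermion is transferred to the impurity. -/
def contract (n : Fin N) (k : Mode N) : Mode N
  | none => k none + k (some n)
  | some m => if m = n then 0 else k (some m)

theorem mFourier_update (n : Fin N) (k : Mode N) (x : Config N) (y : UnitAddCircle) :
    UnitAddTorus.mFourier k (Function.update x (some n) (x none + y))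
      = fourier (k (some n)) y * UnitAddTorus.mFourier (contract n k) x := by
  have hothers : ∏ m ∈ Finset.univ.erase n,
      (fourier (k (some m)) (Function.update x (some n) (x none + y) (some m)) : ℂ)
      = ∏ m ∈ Finset.univ.erase n, fourier (contract n k (some m)) (x (some m)) := by
    refine Finset.prod_congr rfl fun m hm => ?_
    have hmn : m ≠ n := Finset.ne_of_mem_erase hm
    rw [Function.update_of_ne (by simpa using hmn), contract, if_neg hmn]
  have hadd : (fourier (k (some n)) (x none + y) : ℂ)
      = fourier (k (some n)) (x none) * fourier (k (some n)) y := by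
    simp only [fourier_apply, smul_add, AddCircle.toCircle_add, Circle.coe_mul]
  simp only [UnitAddTorus.mFourier, ContinuousMap.coe_mk, Fintype.prod_option]
  rw [← Finset.mul_prod_erase _ _ (Finset.mem_univ n),
    ← Finset.mul_prod_erase _ (fun m => fourier (contract n k (some m)) (x (some m)))
      (Finset.mem_univ n), hothers, Function.update_self, Function.update_of_ne (by simp), hadd]
  simp only [contract, if_true, fourier_zero, one_mul, fourier_add]
  ring

theorem contract_relabel_left_injective {k : Mode N}
    (hk : Function.Injective fun n : Fin N => k (some n)) (n : Fin N) :
    Function.Injective fun σ : Equiv.Perm (Fin N) => contract n (relabel σ k) := by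
  intro σ τ h
  -- A permutation is determined by its values off one point.
  refine (inv_mul_eq_one.1 (Equiv.Perm.card_support_le_one.1 ?_)).symm
  refine (Finset.card_le_card (t := {n}) fun m hm => ?_).trans_eq (Finset.card_singleton n)
  by_contra hmn
  have hmn' : m ≠ n := by simpa using hmn
  have h' := congrFun h (some m)
  simp only [contract, if_neg hmn'] at h'
  have hστ : σ m = τ m := hk h'
  rw [Equiv.Perm.mem_support, Equiv.Perm.mul_apply, hστ] at hm
  exact hm (τ.symm_apply_apply m)

theorem trigPolyMap_slater (k : Mode N) :
    trigPolyMap N (slater k) = ∑ σ, slaterCoeff σ • UnitAddTorus.mFourier (relabel σ k) := by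
  simp only [trigPolyMap, slater, map_sum, Finsupp.linearCombination_single]

theorem integral_conj_eval_slater_mul_update {k : Mode N}
    (hk : Function.Injective fun n : Fin N => k (some n)) (n : Fin N) (y : UnitAddCircle) :
    ∫ x, starRingEnd ℂ ((slater k).eval (Function.update x (some n) (x none + y)))
      * (slater k).eval (Function.update x (some n) (x none + y)) ∂configMeasure N = 1 := by
  let a (σ : Equiv.Perm (Fin N)) : ℂ := slaterCoeff σ * fourier (relabel σ k (some n)) y
  let g : C(Config N, ℂ) := ∑ σ, a σ • UnitAddTorus.mFourier (contract n (relabel σ k))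
  have hg (x : Config N) : (slater k).eval (Function.update x (some n) (x none + y)) = g x := by
    rw [← trigPolyMap_apply, trigPolyMap_slater, ContinuousMap.sum_apply, ContinuousMap.sum_apply]
    refine Finset.sum_congr rfl fun σ _ => ?_
    rw [ContinuousMap.smul_apply, mFourier_update, ContinuousMap.smul_apply, smul_eq_mul,
      smul_eq_mul, ← mul_assoc]
  have hwave : ContinuousMap.toLp 2 (configMeasure N) ℂ g
      = ∑ σ, a σ • planeWave (contract n (relabel σ k)) := by
    rw [map_sum]
    exact Finset.sum_congr rfl fun σ _ => map_smul _ _ _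
  have ha (σ : Equiv.Perm (Fin N)) : ‖a σ‖ = ‖slaterCoeff σ‖ := by
    simp only [a, norm_mul, fourier_apply, Circle.norm_coe, mul_one]
  have hnorm := ContinuousMap.inner_toLp (𝕜 := ℂ) (configMeasure N) g g
  rw [hwave, inner_sum_smul_planeWave_self (contract_relabel_left_injective hk n)] at hnorm
  simp only [ha, sum_norm_slaterCoeff_sq, Complex.ofReal_one] at hnorm
  simp only [hg, mul_comm, hnorm]

namespace System

variable {S : System}

theorem potentialForm_slater [IsFiniteMeasure S.U] {k : Mode S.N}
    (hk : Function.Injective fun n : Fin S.N => k (some n)) :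
    S.potentialForm (slater k) (slater k) = ((S.N * (S.Ubar / S.L) : ℝ) : ℂ) := by
  have hcontact (n : Fin S.N) : Integrable (Function.uncurry fun (x : Config S.N) (y : ℝ) =>
      starRingEnd ℂ ((slater k).eval (S.contact n (x, y)))
        * (slater k).eval (S.contact n (x, y))) ((configMeasure S.N).prod S.U) := by
    have h := integrable_contact (star (trigPolyMap S.N (slater k)) * trigPolyMap S.N (slater k)) n
    simpa only [ContinuousMap.mul_apply, ContinuousMap.star_apply, trigPolyMap_apply,
      ← starRingEnd_apply, Function.uncurry_def] using h
  have hint (n : Fin S.N) : ∫ x, ∫ y, starRingEnd ℂ ((slater k).eval (S.contact n (x, y)))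
      * (slater k).eval (S.contact n (x, y)) ∂S.U ∂configMeasure S.N = S.Ubar := by
    rw [integral_integral_swap (hcontact n)]
    simp only [contact, integral_conj_eval_slater_mul_update hk]
    simp [Ubar]
  refine (Finset.sum_congr rfl fun n _ => congrArg _ (hint n)).trans ?_
  rw [Finset.sum_const, Finset.card_univ, Fintype.card_fin, nsmul_eq_mul]
  push_cast
  ring

theorem energyForm_slater [IsFiniteMeasure S.U] {k : Mode S.N}
    (hk : Function.Injective fun n : Fin S.N => k (some n)) :
    S.energyForm (slater k) (slater k) = ((S.freeEnergy k + S.N * (S.Ubar / S.L) : ℝ) : ℂ) := by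
  have hE (l : Mode S.N) (hl : l ∈ (slater k).support) : S.freeEnergy l = S.freeEnergy k := by
    rw [Finsupp.mem_support_iff, slater, Finsupp.finsetSum_apply] at hl
    obtain ⟨σ, -, hσ⟩ := Finset.exists_ne_zero_of_sum_ne_zero hl
    rw [(Finsupp.single_apply_ne_zero.1 hσ).1, freeEnergy_relabel]
  have hnorm := inner_toWave_slater_self hk
  rw [inner_toWave, Finsupp.sum] at hnorm
  rw [energyForm, potentialForm_slater hk, Complex.ofReal_add, Finsupp.sum,
    Finset.sum_congr rfl fun l hl => by rw [hE l hl, mul_right_comm], ← Finset.sum_mul, hnorm,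
    one_mul]

theorem seaCoeff_eq_slater (n₀ : ℤ) : S.seaCoeff n₀ = slater (S.seaMode n₀) := rfl

theorem energyForm_seaCoeff [IsFiniteMeasure S.U] (hN : Odd S.N) (hN1 : 1 < S.N) (n₀ : ℤ) :
    S.energyForm (S.seaCoeff n₀) (S.seaCoeff n₀)
      = (((S.δk * n₀) ^ 2 / (2 * S.mi) + S.N * (S.Ubar / S.L) : ℝ) : ℂ) := by
  rw [seaCoeff_eq_slater, energyForm_slater (seaMode_some_injective n₀),
    freeEnergy_seaMode hN hN1]

theorem norm_initialState (n₀ : ℤ) : ‖S.initialState n₀‖ = 1 := by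
  rw [Submodule.coe_norm, @norm_eq_sqrt_re_inner ℂ]
  change √(RCLike.re (inner ℂ (slater (S.seaMode n₀)).toWave (slater (S.seaMode n₀)).toWave)) = 1
  rw [inner_toWave_slater_self (seaMode_some_injective n₀), RCLike.one_re, Real.sqrt_one]

end System

end Slater

section Dynamics

namespace System

variable {S : System}

theorem inMomentumDomain_of_amplitude_eq {ψ : fermionSpace S.N} {φ : WaveSpace S.N}
    (h : ∀ k, amplitude φ k = ((S.δk * k none : ℝ) : ℂ) * amplitude (ψ : WaveSpace S.N) k) :
    S.InMomentumDomain ψ := by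
  rw [InMomentumDomain]
  simp only [← h]
  exact (hasSum_norm_amplitude_sq φ).summable

theorem momentum_eq_re_inner_of_amplitude_eq {ψ : fermionSpace S.N} {φ : WaveSpace S.N}
    (h : ∀ k, amplitude φ k = ((S.δk * k none : ℝ) : ℂ) * amplitude (ψ : WaveSpace S.N) k) :
    S.momentum ψ = (inner ℂ (ψ : WaveSpace S.N) φ).re := by
  rw [← (Complex.hasSum_re (hasSum_conj_amplitude_mul (ψ : WaveSpace S.N) φ)).tsum_eq, momentum]
  refine tsum_congr fun k => ?_
  rw [h, mul_left_comm, Complex.re_ofReal_mul, mul_comm (starRingEnd ℂ _), Complex.mul_conj,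
    Complex.ofReal_re, Complex.normSq_eq_norm_sq]

theorem isPropagator_iff_eq_evolution {ι : Type*} (b : HilbertBasis ι ℂ (fermionSpace S.N))
    (e : ι → ℝ)
    (h : ∀ ψ η, S.IsHamiltonian ψ η ↔ ∀ i, inner ℂ (b i) η = e i * inner ℂ (b i) ψ)
    (W : ℝ → (fermionSpace S.N ≃ₗᵢ[ℂ] fermionSpace S.N)) :
    S.IsPropagator W ↔ W = evolution b e := by
  classical
  refine ⟨fun hW => eq_evolution b e hW.zero hW.add fun i => ?_, ?_⟩
  · refine (hW.generator _ _).1 ((h _ _).2 fun i' => ?_)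
    refine (inner_smul_right _ _ _).trans ?_
    rw [orthonormal_iff_ite.1 b.orthonormal]
    split_ifs with hi
    · rw [hi]
    · rw [mul_zero, mul_zero]
  · rintro rfl
    exact
      { zero := evolution_zero b e
        add := evolution_add b e
        continuous := continuous_evolution b e
        generator := fun ψ η => (h ψ η).trans (hasDerivAt_evolution_iff b e ψ η).symm }

theorem two_mul_mi_mul_energy_eq (hN1 : 1 < S.N) (hmi : 0 < S.mi) (n₀ : ℤ) :
    2 * S.mi * ((S.δk * n₀) ^ 2 / (2 * S.mi) + S.N * (S.Ubar / S.L))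
      = (2 * Real.pi / S.L * n₀) ^ 2
        + 2 / Real.pi * S.mi * S.kF * S.Ubar * ((S.N : ℝ) / ((S.N : ℝ) - 1)) := by
  have hN' : (S.N : ℝ) - 1 ≠ 0 := sub_ne_zero.2 (by exact_mod_cast hN1.ne')
  rw [kF, δk]
  field_simp

/-- The coefficients of the initial state as an element of the form core. -/
def seaPoly (S : System) (n₀ : ℤ) : antisymmPoly S.N :=
  ⟨S.seaCoeff n₀, S.seaCoeff_isAntisymm n₀⟩

theorem toFermion_seaPoly (n₀ : ℤ) : toFermion S.N (S.seaPoly n₀) = S.initialState n₀ :=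
  Subtype.ext (coe_toFermion _)

variable [IsFiniteMeasure S.U]

theorem exists_propagator (hL : 0 < S.L) (hmi : 0 < S.mi) (hmh : 0 < S.mh) :
    ∃ V : ℝ → (fermionSpace S.N ≃ₗᵢ[ℂ] fermionSpace S.N), (∀ W, S.IsPropagator W ↔ W = V) ∧
      ∃ (κ : Type) (b : HilbertBasis κ ℂ S.formDomain) (e : κ → ℝ), ∀ t f,
        S.formEmbedding (evolution b e t f) = V t (S.formEmbedding f) := by
  obtain ⟨κ, b, e, hbe, hcomm⟩ := (isFormCompletion_formCore hL hmi hmh).exists_hilbertBasis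
    (denseRange_toFermion S.N) (isCompactOperator_formEmbedding hL hmi hmh)
  simp only [← isHamiltonian_iff_isFriedrichs] at hbe
  exact ⟨evolution b e, isPropagator_iff_eq_evolution b e hbe, hcomm⟩

theorem inMomentumDomain_formEmbedding (hmi : 0 < S.mi) (hmh : 0 < S.mh) (f : S.formDomain) :
    S.InMomentumDomain (S.formEmbedding f) :=
  inMomentumDomain_of_amplitude_eq (amplitude_momentumOperator hmi hmh f)

/-- The bounded operator on the form domain that represents the expectation value of the impurity
momentum. -/
def momentumForm (hmi : 0 < S.mi) (hmh : 0 < S.mh) : S.formDomain →L[ℂ] S.formDomain :=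
  S.formEmbedding.adjoint ∘L (fermionSpace S.N).subtypeL.adjoint ∘L momentumOperator hmi hmh

theorem momentum_formEmbedding (hmi : 0 < S.mi) (hmh : 0 < S.mh) (f : S.formDomain) :
    S.momentum (S.formEmbedding f) = (inner ℂ f (momentumForm hmi hmh f)).re := by
  rw [momentum_eq_re_inner_of_amplitude_eq (amplitude_momentumOperator hmi hmh f), momentumForm,
    ContinuousLinearMap.comp_apply, ContinuousLinearMap.comp_apply,
    ContinuousLinearMap.adjoint_inner_right, ContinuousLinearMap.adjoint_inner_right,
    Submodule.subtypeL_apply]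

theorem abs_momentum_formEmbedding_le (hN : Odd S.N) (hN1 : 1 < S.N) (hmi : 0 < S.mi)
    (hmh : 0 < S.mh) (f : S.formDomain) :
    |S.momentum (S.formEmbedding f)| ≤ ‖S.formEmbedding f‖
      * √(2 * S.mi * (‖f‖ ^ 2 - (1 + S.C) * ‖S.formEmbedding f‖ ^ 2)) := by
  rw [momentum_eq_re_inner_of_amplitude_eq (amplitude_momentumOperator hmi hmh f)]
  refine ((Complex.abs_re_le_norm _).trans (norm_inner_le_norm _ _)).trans ?_
  exact mul_le_mul_of_nonneg_left
    (Real.le_sqrt_of_sq_le (norm_momentumOperator_sq_le hN hN1 hmi hmh f)) (norm_nonneg _)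

section Evolution

variable {κ : Type*} (b : HilbertBasis κ ℂ S.formDomain) (e : κ → ℝ)

theorem continuous_momentum_evolution (hmi : 0 < S.mi) (hmh : 0 < S.mh) (f : S.formDomain) :
    Continuous fun t => S.momentum (S.formEmbedding (evolution b e t f)) := by
  simp only [momentum_formEmbedding hmi hmh]
  exact Complex.continuous_re.comp (continuous_inner_evolution b e _ f f)

theorem exists_hasTimeMean_momentum_evolution (hmi : 0 < S.mi) (hmh : 0 < S.mh)
    (f : S.formDomain) :
    ∃ p, HasTimeMean (fun t => S.momentum (S.formEmbedding (evolution b e t f))) p := by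
  obtain ⟨m, hm⟩ := exists_hasTimeMean_inner_evolution b e (momentumForm hmi hmh) f f
  simp only [momentum_formEmbedding hmi hmh]
  exact ⟨_, hm.mapL Complex.reCLM (continuous_inner_evolution b e _ f f)⟩

end Evolution

/-- The initial state as a vector of the form domain. -/
def seaVector (S : System) [IsFiniteMeasure S.U] (n₀ : ℤ) : S.formDomain :=
  S.formCore (S.seaPoly n₀)

theorem formEmbedding_seaVector (hL : 0 < S.L) (hmi : 0 < S.mi) (hmh : 0 < S.mh) (n₀ : ℤ) :
    S.formEmbedding (S.seaVector n₀) = S.initialState n₀ :=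
  ((isFormCompletion_formCore hL hmi hmh).map_apply _).trans (toFermion_seaPoly n₀)

theorem norm_seaVector_sq (hN : Odd S.N) (hN1 : 1 < S.N) (hL : 0 < S.L) (hmi : 0 < S.mi)
    (hmh : 0 < S.mh) (n₀ : ℤ) :
    ‖S.seaVector n₀‖ ^ 2
      = (S.δk * n₀) ^ 2 / (2 * S.mi) + S.N * (S.Ubar / S.L) + (1 + S.C) := by
  have henergy : S.coreForm (S.seaPoly n₀) (S.seaPoly n₀) = _ := energyForm_seaCoeff hN hN1 n₀
  rw [seaVector, (isFormCompletion_formCore hL hmi hmh).norm_map_sq, henergy, Complex.ofReal_re,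
    toFermion_seaPoly, norm_initialState, one_pow, mul_one]

theorem abs_momentum_formEmbedding_le_of_norm_eq (hN : Odd S.N) (hN1 : 1 < S.N) (hL : 0 < S.L)
    (hmi : 0 < S.mi) (hmh : 0 < S.mh) {n₀ : ℤ} {f : S.formDomain}
    (hf : ‖f‖ = ‖S.seaVector n₀‖) (hf1 : ‖S.formEmbedding f‖ = 1) :
    |S.momentum (S.formEmbedding f)| ≤ √((2 * Real.pi / S.L * n₀) ^ 2
        + 2 / Real.pi * S.mi * S.kF * S.Ubar * ((S.N : ℝ) / ((S.N : ℝ) - 1))) := by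
  have h := abs_momentum_formEmbedding_le hN hN1 hmi hmh f
  rwa [hf1, hf, norm_seaVector_sq hN hN1 hL hmi hmh, one_pow, mul_one, one_mul,
    add_sub_cancel_right, two_mul_mi_mul_energy_eq hN1 hmi] at h

end System

end Dynamics

end MobileImpurity

end

open MobileImpurity in
theorem mainTheorem2_general (S : System) (hN : Odd S.N) (hN1 : 1 < S.N) (hL : 0 < S.L)
    (hmi : 0 < S.mi) (hmh : 0 < S.mh) (hU : IsFiniteMeasure S.U)
    (n₀ : ℤ) (p₀ : ℝ) (hp₀ : p₀ = 2 * Real.pi / S.L * n₀) :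
    (∃! W : ℝ → (fermionSpace S.N ≃ₗᵢ[ℂ] fermionSpace S.N), S.IsPropagator W) ∧
    ∀ W : ℝ → (fermionSpace S.N ≃ₗᵢ[ℂ] fermionSpace S.N), S.IsPropagator W →
      (∀ t, S.InMomentumDomain (W t (S.initialState n₀))) ∧
      (∀ t, IntervalIntegrable (fun s => S.momentum (W s (S.initialState n₀))) volume 0 t) ∧
      ∃ pinf : ℝ,
        Tendsto (fun t : ℝ => 1 / t * ∫ s in (0 : ℝ)..t, S.momentum (W s (S.initialState n₀)))
          atTop (𝓝 pinf) ∧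
        |pinf| ≤ Real.sqrt (p₀ ^ 2
          + 2 / Real.pi * S.mi * S.kF * S.Ubar * ((S.N : ℝ) / ((S.N : ℝ) - 1))) := by
  obtain ⟨V, hV, κ, b, e, hcomm⟩ := System.exists_propagator hL hmi hmh
  refine ⟨⟨V, (hV V).2 rfl, fun W => (hV W).1⟩, fun W hW => ?_⟩
  obtain rfl := (hV W).1 hW
  have hstate t : W t (S.initialState n₀) = S.formEmbedding (evolution b e t (S.seaVector n₀)) := by
    rw [hcomm, System.formEmbedding_seaVector hL hmi hmh]
  have hbound t : |S.momentum (W t (S.initialState n₀))| ≤ √(p₀ ^ 2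
      + 2 / Real.pi * S.mi * S.kF * S.Ubar * ((S.N : ℝ) / ((S.N : ℝ) - 1))) := by
    rw [hp₀, hstate]
    exact System.abs_momentum_formEmbedding_le_of_norm_eq hN hN1 hL hmi hmh
      (LinearIsometryEquiv.norm_map _ _) (by
        rw [← hstate, LinearIsometryEquiv.norm_map, System.norm_initialState])
  obtain ⟨p, hp⟩ := System.exists_hasTimeMean_momentum_evolution b e hmi hmh (S.seaVector n₀)
  simp only [hstate] at hbound ⊢
  exact ⟨fun _ => System.inMomentumDomain_formEmbedding hmi hmh _,
    (System.continuous_momentum_evolution b e hmi hmh _).intervalIntegrable 0,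
    p, hp, hp.norm_le hbound⟩

open MobileImpurity in
theorem mainTheorem2 (S : System) (hN : Odd S.N) (hN1 : 1 < S.N) (hL : 0 < S.L)
    (hmi : 0 < S.mi) (hmh : 0 < S.mh) (hU : IsFiniteMeasure S.U)
    (n₀ : ℤ) (p₀ : ℝ) (hp₀ : p₀ = 2 * Real.pi / S.L * n₀)
    (hnd : S.NondegenerateAt p₀) :
    (∃! W : ℝ → (fermionSpace S.N ≃ₗᵢ[ℂ] fermionSpace S.N), S.IsPropagator W) ∧
    ∀ W : ℝ → (fermionSpace S.N ≃ₗᵢ[ℂ] fermionSpace S.N), S.IsPropagator W →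
      (∀ t, S.InMomentumDomain (W t (S.initialState n₀))) ∧
      (∀ t, IntervalIntegrable (fun s => S.momentum (W s (S.initialState n₀))) volume 0 t) ∧
      ∃ pinf : ℝ,
        Tendsto (fun t : ℝ => 1 / t * ∫ s in (0 : ℝ)..t, S.momentum (W s (S.initialState n₀)))
          atTop (𝓝 pinf) ∧
        |pinf| ≤ Real.sqrt (p₀ ^ 2
          + 2 / Real.pi * S.mi * S.kF * S.Ubar * ((S.N : ℝ) / ((S.N : ℝ) - 1))) :=
  mainTheorem2_general S hN hN1 hL hmi hmh hU n₀ p₀ hp₀
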